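/- Let $k$ be a field of characteristic zero. Let $T$ be the $k$-vector space spanned by the non-empty (non-planar) rooted trees, with the pre-Lie product $t\curvearrowright u$, the sum over the vertices $w$ of $u$ of the tree obtained by joining $w$ to the root of $t$ by a new edge. Let $(A,\rhd)$ be a left pre-Lie $k$-algebra. For $x\in A$ let $F_x:(T,\curvearrowright)\to(A,\rhd)$ be the unique morphism of pre-Lie algebras that maps the one-vertex tree $\bullet$ to $x$. For a linear form $\gamma$ on $T\oplus k\emptyset$ put $$B(\gamma;x)=\gamma(\emptyset)\mathbf 1+\sum_{t}h^{v(t)}\frac{\gamma(t)}{\sigma(t)}F_x(t)\in k\mathbf 1\oplus hA[[h]],$$ where $t$ runs over the non-empty rooted trees, $v(t)$ is the number of vertices and $\sigma(t)=|\mathrm{Aut}\,t|$. The same formula defines $B(\gamma;x)\in k\mathbf 1\oplus hA[[h]]$ for $x\in A[[h]]$, where $A[[h]]$ carries the $h$-linear extension of $\rhd$, $F_x(t)\in A[[h]]$, and the sum converges $h$-adically. Let $\mathcal S(T)$ be the symmetric algebra of $T$, with basis the rooted forests; it is the underlying algebra of both the bialgebra $\widetilde{\mathcal H}$ and the Connes–Kreimer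 Hopf algebra $\mathcal H_{CK}$. The coproduct of $\widetilde{\mathcal H}$ is the algebra morphism $\Delta:\mathcal S(T)\to\mathcal S(T)\otimes\mathcal S(T)$ given on trees by $\Delta(t)=\sum_s s\otimes t/s$. Here $s$ runs over the spanning subforests of $t$ (collections of disjoint subtrees such that each vertex of $t$ belongs to exactly one of them), and $t/s$ is obtained from $t$ by contracting each component of $s$ to a vertex. Let $\alpha,\beta$ be linear forms on $T$, extended to $T\oplus k\emptyset$ by $0$ on $\emptyset$. Then for every $a\in A$ $$B\bigl(\beta;\,h^{-1}B(\alpha;a)\bigr)=B(\alpha\star\beta;a).$$ Here $\alpha\star\beta=m_k\circ(\hat\alpha\otimes\hat\beta)\circ\Delta$, restricted to $T\oplus k\emptyset$ ($\emptyset$ being the empty forest, i.e. the unit of $\mathcal S(T)$), where $m_k$ is the product of $k$, $\hat\alpha$ is the multiplicative extension of $\alpha$ to forests, and $\hat\beta$ is the infinitesimal character of $\mathcal H_{CK}$ extending $\beta$ (it vanishes on the empty forest and on products of at least two trees). -/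

import Mathlib

/-- A rooted tree with a chosen ordering of the children of each vertex:
`node n c` is the tree whose root has the `n` branches `c 0, …, c (n - 1)`. -/
inductive PlaneTree : Type
  | node (n : ℕ) (c : Fin n → PlaneTree) : PlaneTree

namespace PlaneTree

/-- Isomorphisms of rooted trees, disregarding the order of the children: a bijection between
the branches at the roots, together with isomorphisms of the corresponding branches. -/
def Iso : PlaneTree → PlaneTree → Type
  | node n c, node m d => Σ e : Fin n ≃ Fin m, ∀ i, Iso (c i) (d (e i))

theorem Iso.refl : ∀ p : PlaneTree, Nonempty (Iso p p)
  | node _ c => ⟨⟨Equiv.refl _, fun i => (Iso.refl (c i)).some⟩⟩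

theorem Iso.symm : ∀ p q : PlaneTree, Nonempty (Iso p q) → Nonempty (Iso q p)
  | node n c, node m d, ⟨⟨e, f⟩⟩ =>
    ⟨⟨e.symm, fun i => by
      have h := Iso.symm (c (e.symm i)) (d (e (e.symm i))) ⟨f (e.symm i)⟩
      rw [e.apply_symm_apply] at h
      exact h.some⟩⟩

theorem Iso.trans : ∀ p q r : PlaneTree,
    Nonempty (Iso p q) → Nonempty (Iso q r) → Nonempty (Iso p r)
  | node _ c, node _ d, node _ b, ⟨⟨e, f⟩⟩, ⟨⟨e', f'⟩⟩ =>
    ⟨⟨e.trans e', fun i =>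
      (Iso.trans (c i) (d (e i)) (b (e' (e i))) ⟨f i⟩ ⟨f' (e i)⟩).some⟩⟩

instance finiteIso : ∀ p q : PlaneTree, Finite (Iso p q)
  | node n c, node m d => by
    have : ∀ e : Fin n ≃ Fin m, ∀ i, Finite (Iso (c i) (d (e i))) :=
      fun e i => finiteIso (c i) (d (e i))
    exact inferInstanceAs (Finite (Σ e : Fin n ≃ Fin m, ∀ i, Iso (c i) (d (e i))))

/-- Two plane trees are the same (non-planar) rooted tree when they are isomorphic. -/
instance setoid : Setoid PlaneTree where
  r p q := Nonempty (Iso p q)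
  iseqv := ⟨Iso.refl, fun {p q} => Iso.symm p q, fun {p q r} => Iso.trans p q r⟩

/-- The vertices of a tree: the root (`none`) and the vertices of the branches. -/
def Vertex : PlaneTree → Type
  | node n c => Option (Σ i : Fin n, Vertex (c i))

instance fintypeVertex : ∀ p : PlaneTree, Fintype (Vertex p)
  | node n c => by
    have : ∀ i, Fintype (Vertex (c i)) := fun i => fintypeVertex (c i)
    exact inferInstanceAs (Fintype (Option (Σ i : Fin n, Vertex (c i))))

/-- The number of vertices. -/
def order (p : PlaneTree) : ℕ := Fintype.card (Vertex p)

/-- `graftAt t u w` is the tree obtained from `u` by joining the root of `t` to the vertex `w` of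
`u` by a new edge. -/
def graftAt (t : PlaneTree) : (u : PlaneTree) → Vertex u → PlaneTree
  | node n c, none => node (n + 1) (Fin.cons t c)
  | node n c, some ⟨i, w⟩ => node n (Function.update c i (graftAt t (c i) w))

/-- The branches at the root. -/
def children : PlaneTree → List PlaneTree
  | node _ c => List.ofFn c

/-- The tree with a given list of branches at the root. -/
def ofList (l : List PlaneTree) : PlaneTree := node l.length l.get

/-- The sets of edges of a tree. An edge joins the root to the root of the `i`-th branch, or lies
in a branch; the Boolean says whether the edge from the root to the `i`-th branch is in the set.

Spanning subforests of a tree (collections of disjoint subtrees such that every vertex belongs to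
exactly one of them) are the same as sets of edges: the subtrees are the connected components of
the graph formed by all the vertices and the selected edges. -/
def SpanningSubforest : PlaneTree → Type
  | node n c => ∀ i : Fin n, Bool × SpanningSubforest (c i)

instance fintypeSpanningSubforest : ∀ p : PlaneTree, Fintype (SpanningSubforest p)
  | node n c => by
    have : ∀ i, Fintype (SpanningSubforest (c i)) := fun i => fintypeSpanningSubforest (c i)
    exact inferInstanceAs (Fintype (∀ i : Fin n, Bool × SpanningSubforest (c i)))

/-- The component of a spanning subforest that contains the root. -/
def rootComponent : (p : PlaneTree) → SpanningSubforest p → PlaneTree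
  | node n c, s =>
    ofList (((List.finRange n).filter fun i => (s i).1).map fun i => rootComponent (c i) (s i).2)

/-- The multiset of the components of a spanning subforest that do not contain the root. -/
def otherComponents : (p : PlaneTree) → SpanningSubforest p → Multiset PlaneTree
  | node n c, s =>
    ∑ i : Fin n, (otherComponents (c i) (s i).2 +
      if (s i).1 then 0 else {rootComponent (c i) (s i).2})

/-- The contracted tree `p / s`: every component of `s` is contracted to one vertex. -/
def contract : (p : PlaneTree) → SpanningSubforest p → PlaneTree
  | node n c, s =>
    ofList ((List.finRange n).flatMap fun i =>
      if (s i).1 then (contract (c i) (s i).2).children else [contract (c i) (s i).2])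

/-- The components of a spanning subforest. -/
def components (p : PlaneTree) (s : SpanningSubforest p) : Multiset PlaneTree :=
  rootComponent p s ::ₘ otherComponents p s

theorem order_node (n : ℕ) (c : Fin n → PlaneTree) :
    order (node n c) = (∑ i, order (c i)) + 1 := by
  change Fintype.card (Option (Σ i : Fin n, Vertex (c i))) = _
  rw [Fintype.card_option, Fintype.card_sigma]
  rfl

theorem order_graftAt (t : PlaneTree) : ∀ (p : PlaneTree) (w : Vertex p),
    order (graftAt t p w) = order t + order p
  | node n c, none => by
    rw [graftAt, order_node, order_node, Fin.sum_univ_succ]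
    simp only [Fin.cons_zero, Fin.cons_succ]
    omega
  | node n c, some ⟨i, w⟩ => by
    rw [graftAt, order_node, order_node]
    have h : ∀ j, order (Function.update c i (graftAt t (c i) w) j) =
        order (c j) + if j = i then order t else 0 := by
      intro j
      by_cases hj : j = i
      · subst hj
        simp [order_graftAt t (c j) w, add_comm]
      · simp [hj]
    simp only [h, Finset.sum_add_distrib, Finset.sum_ite_eq', Finset.mem_univ, if_true]
    omega

theorem finite_order_lt (m : ℕ) : {p : PlaneTree | p.order < m}.Finite := by
  induction m with
  | zero =>
    have : {p : PlaneTree | p.order < 0} = ∅ := by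
      ext p
      exact iff_of_false (Nat.not_lt_zero _) (Set.notMem_empty p)
    rw [this]; exact Set.finite_empty
  | succ m ih =>
    have : Finite {p : PlaneTree // p.order < m} := ih
    refine Set.Finite.subset (Set.finite_range
      (fun x : Σ n : Fin (m + 1), (Fin n → {p : PlaneTree // p.order < m}) =>
        node x.1 fun i => (x.2 i).1)) ?_
    rintro ⟨n, c⟩ h
    have h' : (∑ i, order (c i)) + 1 < m + 1 := by rw [← order_node]; exact h
    have hpos : ∀ i, 1 ≤ order (c i) := fun i => by
      rcases c i with ⟨l, d⟩
      rw [order_node]; omega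
    have hn : n ≤ ∑ i, order (c i) := by
      calc n = ∑ i : Fin n, 1 := by simp
        _ ≤ _ := Finset.sum_le_sum fun i _ => hpos i
    have hc : ∀ i, order (c i) < m := fun i => by
      have : order (c i) ≤ ∑ i, order (c i) := Finset.single_le_sum
        (f := fun i => order (c i)) (fun _ _ => Nat.zero_le _) (Finset.mem_univ i)
      omega
    exact ⟨⟨⟨n, by omega⟩, fun i => ⟨c i, hc i⟩⟩, rfl⟩

end PlaneTree

/-- Non-empty, non-planar rooted trees. -/
def RTree : Type := Quotient PlaneTree.setoid

namespace RTree

/-- The rooted tree underlying a plane tree. -/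
def mk (p : PlaneTree) : RTree := Quotient.mk _ p

/-- A plane representative of a rooted tree. -/
noncomputable def rep (t : RTree) : PlaneTree := Quotient.out t

theorem mk_rep (t : RTree) : mk t.rep = t := Quotient.out_eq t

theorem mk_eq_mk {p q : PlaneTree} : mk p = mk q ↔ Nonempty (PlaneTree.Iso p q) :=
  Quotient.eq

theorem mk_node {n m : ℕ} {c : Fin n → PlaneTree} {d : Fin m → PlaneTree} (e : Fin n ≃ Fin m)
    (h : ∀ i, mk (c i) = mk (d (e i))) : mk (.node n c) = mk (.node m d) :=
  mk_eq_mk.2 ⟨⟨e, fun i => (mk_eq_mk.1 (h i)).some⟩⟩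

/-- The tree with one vertex. -/
def leaf : RTree := mk (.node 0 Fin.elim0)

/-- The number `v(t)` of vertices of `t`. -/
noncomputable def order (t : RTree) : ℕ := t.rep.order

/-- The symmetry factor `σ(t)`: the number of automorphisms of the rooted tree `t`. -/
noncomputable def symmetryFactor (t : RTree) : ℕ := Nat.card (PlaneTree.Iso t.rep t.rep)

theorem finite_order_eq (n : ℕ) : {t : RTree | t.order = n}.Finite := by
  refine Set.Finite.of_finite_image (f := rep)
    ((PlaneTree.finite_order_lt (n + 1)).subset ?_) ?_
  · rintro _ ⟨t, ht, rfl⟩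
    have : t.order = n := ht
    change t.order < n + 1
    omega
  · intro t _ u _ h
    rw [← mk_rep t, ← mk_rep u, h]

/-- The finite set of rooted trees with `n` vertices. -/
noncomputable def ofOrder (n : ℕ) : Finset RTree := (finite_order_eq n).toFinset

theorem mem_ofOrder {n : ℕ} {t : RTree} : t ∈ ofOrder n ↔ t.order = n := by
  simp [ofOrder]

end RTree

/-- The vector space `T` spanned by the non-empty rooted trees. -/
abbrev TreeSpace (k : Type*) [Semiring k] : Type _ := RTree →₀ k

namespace TreeSpace

variable (k : Type*) [Field k]

/-- A rooted tree as a basis vector of `T`. -/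
noncomputable def tree (t : RTree) : TreeSpace k := Finsupp.single t 1

/-- The sum of all the ways of grafting the tree `t` on a vertex of the tree `u`. -/
noncomputable def graftTree (t u : RTree) : TreeSpace k :=
  ∑ w : PlaneTree.Vertex u.rep, tree k (RTree.mk (PlaneTree.graftAt t.rep u.rep w))

/-- The grafting product `t ↷ u` of `T`, extended bilinearly from trees. -/
noncomputable def graft : TreeSpace k →ₗ[k] TreeSpace k →ₗ[k] TreeSpace k :=
  Finsupp.linearCombination k fun t => Finsupp.linearCombination k fun u => graftTree k t u

variable {k}

theorem graft_tree (t u : RTree) : graft k (tree k t) (tree k u) = graftTree k t u := by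
  simp [graft, tree]

/-- Grafting on vertices does not depend on the chosen plane representatives. -/
theorem exists_vertex_equiv {t t' : PlaneTree} (ht : RTree.mk t = RTree.mk t') :
    ∀ p q : PlaneTree, RTree.mk p = RTree.mk q →
      ∃ e : p.Vertex ≃ q.Vertex, ∀ w,
        RTree.mk (PlaneTree.graftAt t p w) = RTree.mk (PlaneTree.graftAt t' q (e w))
  | .node n c, .node m d, h => by
    obtain ⟨⟨e, f⟩⟩ := RTree.mk_eq_mk.1 h
    have hcd : ∀ i, RTree.mk (c i) = RTree.mk (d (e i)) := fun i => RTree.mk_eq_mk.2 ⟨f i⟩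
    choose E hE using fun i => exists_vertex_equiv ht (c i) (d (e i)) (hcd i)
    refine ⟨(Equiv.sigmaCongr e E).optionCongr, ?_⟩
    rintro (_ | ⟨i, w⟩)
    · refine RTree.mk_node ((finSuccEquiv n).trans
        (e.optionCongr.trans (finSuccEquiv m).symm)) fun i => ?_
      refine Fin.cases ?_ (fun i => ?_) i
      · simpa using ht
      · simpa using hcd i
    · refine RTree.mk_node e fun j => ?_
      change RTree.mk (Function.update c i (PlaneTree.graftAt t (c i) w) j) =
        RTree.mk (Function.update d (e i) (PlaneTree.graftAt t' (d (e i)) (E i w)) (e j))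
      by_cases h : j = i
      · subst h
        simpa using hE j w
      · have h' : e j ≠ e i := fun h' => h (e.injective h')
        rw [Function.update_of_ne h, Function.update_of_ne h', hcd]

theorem graft_mk (t u : PlaneTree) :
    graft k (tree k (RTree.mk t)) (tree k (RTree.mk u)) =
      ∑ w : u.Vertex, tree k (RTree.mk (PlaneTree.graftAt t u w)) := by
  rw [graft_tree, graftTree]
  obtain ⟨e, he⟩ := exists_vertex_equiv (RTree.mk_rep (RTree.mk t)) _ _ (RTree.mk_rep (RTree.mk u))
  exact Fintype.sum_equiv e _ _ fun w => by rw [he]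

end TreeSpace

section PreLie

variable {A : Type*} [LeftPreLieRing A]

/-- The symmetric brace `a{v 0, …, v (n - 1)}` of a left pre-Lie algebra. -/
def brace (a : A) : (n : ℕ) → (Fin n → A) → A
  | 0, _ => a
  | n + 1, v => v 0 * brace a n (Fin.tail v) -
      ∑ i, brace a n (Function.update (Fin.tail v) i (v 0 * Fin.tail v i))

theorem brace_cons (a : A) (n : ℕ) (x : A) (v : Fin n → A) :
    brace a (n + 1) (Fin.cons x v) =
      x * brace a n v - ∑ i, brace a n (Function.update v i (x * v i)) := by
  simp [brace]

theorem brace_update_add (a : A) : ∀ (n : ℕ) (v : Fin n → A) (j : Fin n) (x y : A),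
    brace a n (Function.update v j (x + y)) =
      brace a n (Function.update v j x) + brace a n (Function.update v j y) := by
  intro n
  induction n with
  | zero => intro v j; exact j.elim0
  | succ n ih =>
    intro v j x y
    rw [← Fin.cons_self_tail v]
    generalize v 0 = z
    generalize Fin.tail v = u
    refine Fin.cases ?_ (fun j => ?_) j
    · simp only [Fin.update_cons_zero, brace_cons, add_mul, ih, Finset.sum_add_distrib]
      abel
    · simp only [← Fin.cons_update, brace_cons, ih, mul_add]
      have : ∀ i, brace a n (Function.update (Function.update u j (x + y)) i
            (z * Function.update u j (x + y) i)) =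
          brace a n (Function.update (Function.update u j x) i (z * Function.update u j x i)) +
          brace a n (Function.update (Function.update u j y) i
            (z * Function.update u j y i)) := by
        intro i
        by_cases h : i = j
        · subst h; simp [mul_add, ih]
        · simp only [Function.update_of_ne h, Function.update_comm (Ne.symm h), ih]
      simp only [this, Finset.sum_add_distrib]
      abel

theorem brace_update_sum (a : A) {n : ℕ} (v : Fin n → A) (j : Fin n) {ι : Type*}
    (s : Finset ι) (f : ι → A) :
    brace a n (Function.update v j (∑ i ∈ s, f i)) =
      ∑ i ∈ s, brace a n (Function.update v j (f i)) :=
  map_sum (AddMonoidHom.mk' (fun x => brace a n (Function.update v j x))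
    (brace_update_add a n v j)) f s

theorem brace_swap_zero (a x y : A) (n : ℕ) (w : Fin n → A) :
    brace a (n + 2) (Fin.cons x (Fin.cons y w)) = brace a (n + 2) (Fin.cons y (Fin.cons x w)) := by
  have expand : ∀ x y : A, brace a (n + 2) (Fin.cons x (Fin.cons y w)) =
      (x * (y * brace a n w) - x * y * brace a n w)
      - (∑ i, x * brace a n (Function.update w i (y * w i)) +
         ∑ i, y * brace a n (Function.update w i (x * w i)))
      + ∑ j, (brace a n (Function.update w j (x * y * w j)) +
          ∑ i, brace a n (Function.update (Function.update w j (x * w j)) i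
            (y * Function.update w j (x * w j) i))) := by
    intro x y
    rw [brace_cons, brace_cons, Fin.sum_univ_succ]
    simp only [Fin.cons_zero, Fin.cons_succ, Fin.update_cons_zero, ← Fin.cons_update, brace_cons,
      Finset.sum_sub_distrib, mul_sub, Finset.mul_sum, Finset.sum_add_distrib]
    abel
  have split : ∀ x y : A, ∀ j, ∑ i, brace a n (Function.update (Function.update w j (x * w j)) i
            (y * Function.update w j (x * w j) i)) =
      brace a n (Function.update w j (y * (x * w j))) +
        ∑ i ∈ Finset.univ.erase j, brace a n (Function.update (Function.update w j (x * w j)) i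
          (y * w i)) := by
    intro x y j
    rw [← Finset.add_sum_erase _ _ (Finset.mem_univ j)]
    congr 1
    · simp
    · refine Finset.sum_congr rfl fun i hi => ?_
      rw [Function.update_of_ne (Finset.ne_of_mem_erase hi)]
  have hsym : ∑ j, ∑ i ∈ Finset.univ.erase j,
        brace a n (Function.update (Function.update w j (x * w j)) i (y * w i)) =
      ∑ j, ∑ i ∈ Finset.univ.erase j,
        brace a n (Function.update (Function.update w j (y * w j)) i (x * w i)) := by
    rw [Finset.sum_comm' (t' := Finset.univ) (s' := fun i => Finset.univ.erase i)]
    · refine Finset.sum_congr rfl fun i _ => Finset.sum_congr rfl fun j hj => ?_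
      rw [Function.update_comm (Finset.ne_of_mem_erase hj)]
    · intro i j; simp [ne_comm]
  have hass : ∀ z : A, x * y * z - x * (y * z) = y * x * z - y * (x * z) :=
    fun z => LeftPreLieRing.assoc_symm x y z
  have hdiag : ∀ j, brace a n (Function.update w j (x * y * w j)) +
        brace a n (Function.update w j (y * (x * w j))) =
      brace a n (Function.update w j (y * x * w j)) +
        brace a n (Function.update w j (x * (y * w j))) := by
    intro j
    rw [← brace_update_add, ← brace_update_add]
    congr 2
    have := hass (w j)
    rw [sub_eq_sub_iff_add_eq_add] at this
    exact this
  rw [expand x y, expand y x]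
  simp only [split, ← add_assoc, hdiag]
  rw [Finset.sum_add_distrib (f := fun j => brace a n (Function.update w j (y * x * w j)) +
    brace a n (Function.update w j (x * (y * w j)))), hsym, ← Finset.sum_add_distrib]
  have h1 := hass (brace a n w)
  have h2 : x * (y * brace a n w) - x * y * brace a n w =
      y * (x * brace a n w) - y * x * brace a n w := by
    rw [← neg_sub, h1, neg_sub]
  rw [h2]
  simp only [Finset.sum_add_distrib]
  abel

theorem brace_perm (a : A) : ∀ (n : ℕ) (v : Fin n → A) (e : Equiv.Perm (Fin n)),
    brace a n (v ∘ e) = brace a n v := by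
  intro n
  induction n with
  | zero => intro v e; rfl
  | succ n ih =>
    intro v e
    have key : ∀ (v : Fin (n + 1) → A) (i : Fin n),
        brace a (n + 1) (v ∘ Equiv.swap i.castSucc i.succ) = brace a (n + 1) v := by
      intro v i
      rw [← Fin.cons_self_tail v]
      generalize v 0 = x
      generalize Fin.tail v = u
      rcases n with _ | n
      · exact i.elim0
      refine Fin.cases ?_ (fun j => ?_) i
      · have : (Fin.cons x u : Fin (n + 2) → A) ∘ Equiv.swap (Fin.castSucc 0) (Fin.succ 0) =
            Fin.cons (u 0) (Fin.cons x (Fin.tail u)) := by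
          funext l
          refine Fin.cases ?_ (fun l => ?_) l
          · simp
          · refine Fin.cases ?_ (fun l => ?_) l
            · simp
            · rw [Function.comp_apply, Equiv.swap_apply_of_ne_of_ne]
              · simp [Fin.tail]
              · simp [Fin.ext_iff]
              · simp [Fin.ext_iff]
        rw [this, brace_swap_zero, Fin.cons_self_tail]
      · have : (Fin.cons x u : Fin (n + 2) → A) ∘ Equiv.swap j.succ.castSucc j.succ.succ =
            Fin.cons x (u ∘ Equiv.swap j.castSucc j.succ) := by
          funext l
          refine Fin.cases ?_ (fun l => ?_) l
          · rw [Function.comp_apply, Equiv.swap_apply_of_ne_of_ne] <;> simp [Fin.ext_iff]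
          · rw [Function.comp_apply, Fin.cons_succ, Function.comp_apply, ← Fin.succ_castSucc,
              ← (Fin.succ_injective _).map_swap, Fin.cons_succ]
        rw [this, brace_cons, brace_cons, ih]
        congr 1
        refine Fintype.sum_equiv (Equiv.swap j.castSucc j.succ) _ _ fun l => ?_
        rw [← ih (Function.update u _ _) (Equiv.swap j.castSucc j.succ)]
        congr 1
        rw [Function.update_comp_equiv]
        simp
    have he : e ∈ Submonoid.closure
        (Set.range fun i : Fin n => Equiv.swap i.castSucc i.succ) := by
      rw [Equiv.Perm.mclosure_swap_castSucc_succ]; trivial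
    induction he using Submonoid.closure_induction generalizing v with
    | mem x hx => obtain ⟨i, rfl⟩ := hx; exact key v i
    | one => rfl
    | mul x y _ _ hx hy =>
      rw [show v ∘ ⇑(x * y) = (v ∘ x) ∘ y from rfl, hy, hx]

/-- The elementary differential of a plane tree: `a` for the one-vertex tree, and the brace
`a{F (c 0), …, F (c (n - 1))}` for the tree with branches `c 0, …, c (n - 1)`. -/
def planeDiff (a : A) : PlaneTree → A
  | .node n c => brace a n fun i => planeDiff a (c i)

theorem planeDiff_iso (a : A) : ∀ p q : PlaneTree, Nonempty (PlaneTree.Iso p q) →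
    planeDiff a p = planeDiff a q
  | .node n c, .node m d, ⟨⟨e, f⟩⟩ => by
    obtain rfl : n = m := by simpa using Fintype.card_congr e
    have : (fun i => planeDiff a (c i)) = (fun i => planeDiff a (d i)) ∘ e := by
      funext i
      exact planeDiff_iso a (c i) (d (e i)) ⟨f i⟩
    rw [planeDiff, planeDiff, this, brace_perm]

theorem sum_planeDiff_graftAt (a : A) (t : PlaneTree) : ∀ p : PlaneTree,
    ∑ w : p.Vertex, planeDiff a (PlaneTree.graftAt t p w) = planeDiff a t * planeDiff a p
  | .node n c => by
    have h1 : ∑ w : PlaneTree.Vertex (.node n c), planeDiff a (PlaneTree.graftAt t (.node n c) w) =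
        planeDiff a (.node (n + 1) (Fin.cons t c)) +
          ∑ i, ∑ w : (c i).Vertex,
            planeDiff a (.node n (Function.update c i (PlaneTree.graftAt t (c i) w))) := by
      rw [← Fintype.sum_sigma']
      exact Fintype.sum_option
        (α := Σ i : Fin n, (c i).Vertex)
        (fun w => planeDiff a (PlaneTree.graftAt t (.node n c) w))
    have h2 : ∀ i, ∀ w : (c i).Vertex,
        planeDiff a (.node n (Function.update c i (PlaneTree.graftAt t (c i) w))) =
          brace a n (Function.update (fun j => planeDiff a (c j)) i
            (planeDiff a (PlaneTree.graftAt t (c i) w))) := by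
      intro i w
      rw [planeDiff]
      congr 1
      funext j
      by_cases h : j = i
      · subst h; simp
      · simp [h]
    have h3 : planeDiff a (.node (n + 1) (Fin.cons t c)) =
        brace a (n + 1) (Fin.cons (planeDiff a t) fun j => planeDiff a (c j)) := by
      rw [planeDiff]
      congr 1
      funext j
      refine Fin.cases ?_ (fun j => ?_) j <;> simp
    simp only [h1, h2, h3, ← brace_update_sum, sum_planeDiff_graftAt a t, brace_cons]
    rw [sub_add_cancel, planeDiff]

end PreLie

section UniversalProperty

variable (k : Type*) [Field k] {A : Type*} [LeftPreLieRing A] [LeftPreLieAlgebra k A]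

/-- `F : T → A` is a morphism of pre-Lie algebras that maps the one-vertex tree to `a`. -/
def IsTreeMorphism (a : A) (F : TreeSpace k →ₗ[k] A) : Prop :=
  (∀ x y, F (TreeSpace.graft k x y) = F x * F y) ∧ F (TreeSpace.tree k RTree.leaf) = a

variable {k} in
open TreeSpace in
theorem treeMorphism_ext {a : A} {F G : TreeSpace k →ₗ[k] A} (hF : IsTreeMorphism k a F)
    (hG : IsTreeMorphism k a G) : F = G := by
  have key : ∀ (N n : ℕ) (c : Fin n → PlaneTree), (PlaneTree.node n c).order = N →
      F (tree k (RTree.mk (.node n c))) = G (tree k (RTree.mk (.node n c))) := by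
    intro N
    induction N using Nat.strong_induction_on with
    | _ N ihN =>
    intro n
    induction n with
    | zero =>
      intro c _
      have : RTree.mk (.node 0 c) = RTree.leaf :=
        RTree.mk_node (Equiv.refl _) fun i => i.elim0
      rw [this, hF.2, hG.2]
    | succ n ih =>
      intro c hc
      rw [← Fin.cons_self_tail c] at hc ⊢
      generalize c 0 = t at hc ⊢
      generalize Fin.tail c = d at hc ⊢
      have hsum : ∀ H : TreeSpace k →ₗ[k] A, IsTreeMorphism k a H →
          H (tree k (RTree.mk t)) * H (tree k (RTree.mk (.node n d))) =
            H (tree k (RTree.mk (.node (n + 1) (Fin.cons t d)))) +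
              ∑ i, ∑ w : (d i).Vertex, H (tree k (RTree.mk
                (.node n (Function.update d i (PlaneTree.graftAt t (d i) w))))) := by
        intro H hH
        rw [← hH.1, graft_mk, map_sum, ← Fintype.sum_sigma']
        exact Fintype.sum_option (α := Σ i : Fin n, (d i).Vertex)
          (fun w => H (tree k (RTree.mk (PlaneTree.graftAt t (.node n d) w))))
      have hord : t.order + (PlaneTree.node n d).order = N := by
        rw [← hc, PlaneTree.order_node, PlaneTree.order_node, Fin.sum_univ_succ]
        simp only [Fin.cons_zero, Fin.cons_succ]
        omega
      have ht : F (tree k (RTree.mk t)) = G (tree k (RTree.mk t)) := by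
        rcases t with ⟨m, b⟩
        refine ihN _ ?_ m b rfl
        rw [PlaneTree.order_node n] at hord
        omega
      have hu : F (tree k (RTree.mk (.node n d))) = G (tree k (RTree.mk (.node n d))) := by
        refine ihN _ ?_ n d rfl
        rcases t with ⟨m, b⟩
        rw [PlaneTree.order_node m] at hord
        omega
      have hrest : ∀ i, ∀ w : (d i).Vertex,
          F (tree k (RTree.mk (.node n (Function.update d i (PlaneTree.graftAt t (d i) w))))) =
          G (tree k (RTree.mk
            (.node n (Function.update d i (PlaneTree.graftAt t (d i) w))))) := by
        intro i w
        refine ih _ ?_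
        rw [← hord]
        exact PlaneTree.order_graftAt t (.node n d) (some ⟨i, w⟩)
      have h1 := hsum F hF
      have h2 := hsum G hG
      simp only [ht, hu, hrest] at h1
      exact add_right_cancel (h1.symm.trans h2)
  ext t
  have := RTree.mk_rep t
  rcases h : t.rep with ⟨n, c⟩
  rw [h] at this
  subst this
  exact key _ n c rfl

open TreeSpace in
/-- The space of rooted trees is the free left pre-Lie algebra on the one-vertex tree. -/
theorem existsUnique_treeMorphism (a : A) :
    ∃! F : TreeSpace k →ₗ[k] A, IsTreeMorphism k a F := by
  refine existsUnique_of_exists_of_unique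
    ⟨Finsupp.linearCombination k fun t : RTree => planeDiff a t.rep, ?_, ?_⟩
    fun F G hF hG => treeMorphism_ext hF hG
  · have hmk : ∀ p, Finsupp.linearCombination k (fun t : RTree => planeDiff a t.rep)
        (tree k (RTree.mk p)) = planeDiff a p := by
      intro p
      simp only [tree, Finsupp.linearCombination_single, one_smul]
      exact planeDiff_iso a _ _ (RTree.mk_eq_mk.1 (RTree.mk_rep _))
    generalize Finsupp.linearCombination k (fun t : RTree => planeDiff a t.rep) = F at hmk
    have : (graft k).compr₂ F = (LinearMap.mul k A).compl₁₂ F F := by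
      ext t u
      have ht := RTree.mk_rep t
      have hu := RTree.mk_rep u
      change F (graft k (tree k t) (tree k u)) = F (tree k t) * F (tree k u)
      rw [← ht, ← hu, graft_mk, map_sum]
      simp only [hmk, sum_planeDiff_graftAt]
    intro x y
    exact LinearMap.congr_fun₂ this x y
  · simp only [tree, Finsupp.linearCombination_single, one_smul]
    rw [planeDiff_iso a _ _ (RTree.mk_eq_mk.1 (RTree.mk_rep RTree.leaf))]
    rfl

end UniversalProperty

/-! ### The pre-Lie algebra `A[[h]]` -/

section FormalSeries

variable {A : Type*}

theorem FormalSeries.coeff_mul [NonUnitalNonAssocRing A] (x y : HahnSeries ℕ A)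
    (n : ℕ) : (x * y).coeff n = ∑ p ∈ Finset.HasAntidiagonal.antidiagonal n, x.coeff p.1 * y.coeff p.2 := by
  rw [HahnSeries.coeff_mul]
  refine Finset.sum_subset (fun p hp => ?_) (fun p hp hp' => ?_)
  · exact Finset.HasAntidiagonal.mem_antidiagonal.2 (Finset.mem_antidiagonal.1 hp).2.2
  · by_contra hne
    refine hp' (Finset.mem_antidiagonal.2
      ⟨?_, ?_, Finset.HasAntidiagonal.mem_antidiagonal.1 hp⟩)
    · exact fun h0 => hne (by rw [h0, zero_mul])
    · exact fun h0 => hne (by rw [h0, mul_zero])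

/-- Formal power series with coefficients in a left pre-Lie ring, with the product extended
`h`-linearly, form a left pre-Lie ring. -/
noncomputable instance FormalSeries.leftPreLieRing [LeftPreLieRing A] : LeftPreLieRing (HahnSeries ℕ A) where
  assoc_symm' x y z := by
    have key : ∀ x y z : HahnSeries ℕ A, ∀ n, (associator x y z).coeff n =
        ∑ p ∈ Finset.HasAntidiagonal.antidiagonal n, ∑ q ∈ Finset.HasAntidiagonal.antidiagonal p.1,
          associator (x.coeff q.1) (y.coeff q.2) (z.coeff p.2) := by
      intro x y z n
      have h : (x * (y * z)).coeff n =
          ∑ p ∈ Finset.HasAntidiagonal.antidiagonal n, ∑ q ∈ Finset.HasAntidiagonal.antidiagonal p.1,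
            x.coeff q.1 * (y.coeff q.2 * z.coeff p.2) := by
        simp only [FormalSeries.coeff_mul, Finset.mul_sum, Finset.sum_sigma']
        refine Finset.sum_nbij' (fun s => ⟨(s.1.1 + s.2.1, s.2.2), (s.1.1, s.2.1)⟩)
          (fun s => ⟨(s.2.1, s.2.2 + s.1.2), (s.2.2, s.1.2)⟩) ?_ ?_ ?_ ?_ ?_
        · rintro ⟨⟨a, b⟩, ⟨c, d⟩⟩ h
          simp at h ⊢; omega
        · rintro ⟨⟨a, b⟩, ⟨c, d⟩⟩ h
          simp at h ⊢; omega
        · rintro ⟨⟨a, b⟩, ⟨c, d⟩⟩ h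
          simp at h ⊢; omega
        · rintro ⟨⟨a, b⟩, ⟨c, d⟩⟩ h
          simp at h ⊢; omega
        · rintro ⟨⟨a, b⟩, ⟨c, d⟩⟩ h
          rfl
      rw [associator_apply, HahnSeries.coeff_sub, h]
      simp only [FormalSeries.coeff_mul, Finset.sum_mul, ← Finset.sum_sub_distrib,
        associator_apply]
    ext n
    rw [key, key]
    refine Finset.sum_congr rfl fun p _ => ?_
    rw [← Finset.Nat.sum_antidiagonal_swap]
    exact Finset.sum_congr rfl fun q _ => LeftPreLieRing.assoc_symm _ _ _

noncomputable instance FormalSeries.leftPreLieAlgebra {k : Type*} [CommRing k] [LeftPreLieRing A]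
    [LeftPreLieAlgebra k A] : LeftPreLieAlgebra k (HahnSeries ℕ A) where
  smul_assoc r x y := by
    ext n
    simp [FormalSeries.coeff_mul, Finset.smul_sum, smul_mul_assoc]
  smul_comm r x y := by
    ext n
    simp [FormalSeries.coeff_mul, Finset.smul_sum, mul_smul_comm]

/-- The formal power series `∑ n, h ^ n * c n`. -/
def formalSeries [Zero A] (c : ℕ → A) : HahnSeries ℕ A where
  coeff := c
  isPWO_support' := Set.IsWF.isPWO (Set.IsWF.of_wellFoundedLT _)

@[simp]
theorem coeff_formalSeries [Zero A] (c : ℕ → A) (n : ℕ) : (formalSeries c).coeff n = c n := rfl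

/-- Division by `h`: on the space `h A[[h]]` of the series without constant term, this is the
inverse of the multiplication by `h`. -/
def divH [Zero A] (x : HahnSeries ℕ A) : HahnSeries ℕ A := formalSeries fun n => x.coeff (n + 1)

end FormalSeries

/-! ### The bialgebra of rooted forests -/

section Forests

variable (k : Type*) [Field k]

/-- The symmetric algebra `S(T)`, with basis the rooted forests: it is the common underlying algebra
of the bialgebra `H̃` and of the Connes–Kreimer Hopf algebra. The unit is the empty forest. -/
abbrev ForestAlgebra : Type _ := MvPolynomial RTree k

namespace ForestAlgebra

open scoped TensorProduct

/-- The product of the trees of a forest. -/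
noncomputable def forest (s : Multiset PlaneTree) : ForestAlgebra k :=
  (s.map fun p => MvPolynomial.X (RTree.mk p)).prod

/-- The coproduct of `H̃` on a tree: the sum over the spanning subforests `s` of `t` of
`s ⊗ t / s`. -/
noncomputable def treeCoproduct (t : RTree) : ForestAlgebra k ⊗[k] ForestAlgebra k :=
  ∑ s : PlaneTree.SpanningSubforest t.rep,
    forest k (PlaneTree.components t.rep s) ⊗ₜ[k]
      MvPolynomial.X (RTree.mk (PlaneTree.contract t.rep s))

/-- The coproduct of `H̃`, the multiplicative extension of `treeCoproduct`. It is also the left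
coaction of `H̃` on the Connes–Kreimer Hopf algebra. -/
noncomputable def coproduct : ForestAlgebra k →ₐ[k] ForestAlgebra k ⊗[k] ForestAlgebra k :=
  MvPolynomial.aeval (treeCoproduct k)

variable {k}

/-- The convolution product `φ ⋆ ψ = m ∘ (φ ⊗ ψ) ∘ Δ` for the coproduct of `H̃`. -/
noncomputable def convolution (φ ψ : ForestAlgebra k →ₗ[k] k) : ForestAlgebra k →ₗ[k] k :=
  LinearMap.mul' k k ∘ₗ TensorProduct.map φ ψ ∘ₗ (coproduct k).toLinearMap

/-- The multiplicative extension to forests of a linear form on `T`. -/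
noncomputable def character (α : Module.Dual k (TreeSpace k)) : ForestAlgebra k →ₐ[k] k :=
  MvPolynomial.aeval fun t => α (TreeSpace.tree k t)

/-- The infinitesimal character that extends a linear form on `T`: it vanishes on the empty forest
and on the forests with at least two trees. -/
noncomputable def infinitesimalCharacter (β : Module.Dual k (TreeSpace k)) :
    ForestAlgebra k →ₗ[k] k :=
  (MvPolynomial.basisMonomials RTree k).constr k fun m =>
    if m.degree = 1 then ∑ t ∈ m.support, β (TreeSpace.tree k t) else 0

theorem infinitesimalCharacter_monomial (β : Module.Dual k (TreeSpace k)) (m : RTree →₀ ℕ) :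
    infinitesimalCharacter β (MvPolynomial.monomial m 1) =
      if m.degree = 1 then ∑ t ∈ m.support, β (TreeSpace.tree k t) else 0 := by
  rw [show MvPolynomial.monomial m (1 : k) = MvPolynomial.basisMonomials RTree k m by simp,
    infinitesimalCharacter, Module.Basis.constr_basis]

theorem infinitesimalCharacter_X (β : Module.Dual k (TreeSpace k)) (t : RTree) :
    infinitesimalCharacter β (MvPolynomial.X t) = β (TreeSpace.tree k t) := by
  rw [MvPolynomial.X, infinitesimalCharacter_monomial, if_pos (by simp),
    Finsupp.support_single _ one_ne_zero, Finset.sum_singleton]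

theorem infinitesimalCharacter_mul (β : Module.Dual k (TreeSpace k)) (x y : ForestAlgebra k) :
    infinitesimalCharacter β (x * y) =
      infinitesimalCharacter β x * MvPolynomial.constantCoeff y +
        MvPolynomial.constantCoeff x * infinitesimalCharacter β y := by
  classical
  induction x using MvPolynomial.induction_on' with
  | add p q hp hq => simp only [add_mul, map_add, hp, hq]; ring
  | monomial m r =>
  induction y using MvPolynomial.induction_on' with
  | add p q hp hq => simp only [mul_add, map_add, hp, hq]; ring
  | monomial l u =>
  have hr : ∀ (m : RTree →₀ ℕ) (r : k), infinitesimalCharacter β (MvPolynomial.monomial m r) =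
      r * infinitesimalCharacter β (MvPolynomial.monomial m 1) := by
    intro m r
    rw [← smul_eq_mul, ← map_smul, MvPolynomial.smul_monomial, smul_eq_mul, mul_one]
  rw [MvPolynomial.monomial_mul, hr, hr m, hr l, MvPolynomial.constantCoeff_monomial,
    MvPolynomial.constantCoeff_monomial]
  simp only [infinitesimalCharacter_monomial]
  by_cases hm : m = 0
  · by_cases hl : l = 0
    · simp [hm, hl]
    · simp [hm, hl, mul_assoc]
  · by_cases hl : l = 0
    · simp [hm, hl, mul_left_comm, mul_assoc, mul_comm]
    · have h1 : m.degree ≠ 0 := fun h => hm ((Finsupp.degree_eq_zero_iff m).1 h)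
      have h2 : l.degree ≠ 0 := fun h => hl ((Finsupp.degree_eq_zero_iff l).1 h)
      have h3 : (m + l).degree ≠ 1 := by
        rw [map_add]; omega
      rw [if_neg h3, if_neg hm, if_neg hl]
      ring

/-- The restriction of a linear form on forests to a linear form on `T ⊕ k∅`, where `∅` is the
empty forest. -/
noncomputable def restrict (φ : ForestAlgebra k →ₗ[k] k) : Module.Dual k (TreeSpace k × k) :=
  φ ∘ₗ LinearMap.coprod (Finsupp.linearCombination k MvPolynomial.X)
    (Algebra.linearMap k (ForestAlgebra k))

end ForestAlgebra

end Forests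

/-! ### B-series -/

section BSeries

variable {k : Type*} [Field k] {A : Type*} [LeftPreLieRing A] [LeftPreLieAlgebra k A]

variable (k) in
/-- The morphism of pre-Lie algebras `F_a : T → A` that maps the one-vertex tree to `a`. -/
noncomputable def elementaryDifferential (a : A) : TreeSpace k →ₗ[k] A :=
  (existsUnique_treeMorphism k a).choose

variable (k) in
theorem elementaryDifferential_spec (a : A) :
    IsTreeMorphism k a (elementaryDifferential k a) :=
  (existsUnique_treeMorphism k a).choose_spec.1

/-- The weight `γ(t) / σ(t)` of a tree in a B-series. -/
noncomputable def bWeight (γ : Module.Dual k (TreeSpace k × k)) (t : RTree) : k :=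
  γ (TreeSpace.tree k t, 0) / (t.symmetryFactor : k)

/-- The B-series `B(γ; a) = γ(∅) 𝟏 + ∑ t, h ^ v(t) γ(t) / σ(t) F_a(t)` of an element `a` of `A`,
for a linear form `γ` on `T ⊕ k∅`. The first component is the coefficient of `𝟏`. -/
noncomputable def bSeries (γ : Module.Dual k (TreeSpace k × k)) (a : A) : k × HahnSeries ℕ A :=
  (γ (0, 1), formalSeries fun n => ∑ t ∈ RTree.ofOrder n,
    bWeight γ t • elementaryDifferential k a (TreeSpace.tree k t))

/-- The B-series `B(γ; x)` of a formal series `x ∈ A[[h]]`, with the same parameter `h`: the sum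
`γ(∅) 𝟏 + ∑ t, h ^ v(t) γ(t) / σ(t) F_x(t)`, where `F_x(t) ∈ A[[h]]`, which converges in the
`h`-adic topology. -/
noncomputable def formalBSeries (γ : Module.Dual k (TreeSpace k × k)) (x : HahnSeries ℕ A) :
    k × HahnSeries ℕ A :=
  (γ (0, 1), formalSeries fun n => ∑ m ∈ Finset.range (n + 1), ∑ t ∈ RTree.ofOrder m,
    bWeight γ t • (elementaryDifferential k x (TreeSpace.tree k t)).coeff (n - m))

theorem coeff_zero_bSeries (γ : Module.Dual k (TreeSpace k × k)) (a : A) :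
    (bSeries γ a).2.coeff 0 = 0 := by
  have : RTree.ofOrder 0 = ∅ := by
    refine Finset.eq_empty_of_forall_notMem fun t ht => ?_
    have h : t.rep.order = 0 := RTree.mem_ofOrder.1 ht
    rcases h' : t.rep with ⟨n, c⟩
    rw [h', PlaneTree.order_node] at h
    omega
  simp [bSeries, this]

/-- The extension by `0` on `∅` of a linear form on `T`. -/
noncomputable def extendByZero (α : Module.Dual k (TreeSpace k)) :
    Module.Dual k (TreeSpace k × k) :=
  α ∘ₗ LinearMap.fst k (TreeSpace k) k

end BSeries

/-!
For `x = B(α; a)`, linearity in `β` reduces the theorem to the expansion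
`F_x(u) = ∑ t, h ^ v(t) (α ⋆ δ_u)(t) / σ(t) F_a(t)` for all trees `u`, where `δ_u` is the linear
form `t ↦ ⟨u, t⟩` of the pairing `⟨u, t⟩ = σ(t) δ_{u, t}`. Indeed `F_{h y}(u) = h ^ v(u) F_y(u)`, so
that `B(β; h⁻¹ x) = ∑ u, β(u) / σ(u) F_x(u)`. Both sides of the expansion agree for the one-vertex
tree, hence by the universal property of `T` it is enough to prove that the right-hand side is a
morphism of pre-Lie algebras in `u`. There are two reasons for this. First, `⟨u, t⟩` counts the
isomorphisms from `u` to `t`, and a double count shows that grafting is dual to cutting one edge.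
Second, the edges of `t / s` are the edges of `t` that do not belong to the spanning subforest `s`,
and cutting one of them splits `s` into spanning subforests of the two parts of `t`; hence
`f ↦ α ⋆ f` is a morphism for the product dual to cutting an edge.
-/

namespace PlaneTree

theorem children_ofList (l : List PlaneTree) : (ofList l).children = l := List.ofFn_get l

theorem ofList_children : ∀ p : PlaneTree, ofList p.children = p
  | node n c => congrArg (fun s : Σ n, Fin n → PlaneTree => node s.1 s.2)
      (List.equivSigmaTuple.right_inv ⟨n, c⟩)

/-- The one-vertex plane tree. -/
def leaf : PlaneTree := node 0 Fin.elim0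

/-- The Butcher product: `attach t u` is obtained from `u` by adding `t` as a first branch at the
root. Every plane tree is obtained from `leaf` by this operation in exactly one way. -/
def attach (t : PlaneTree) : PlaneTree → PlaneTree
  | node n c => node (n + 1) (Fin.cons t c)

/-- The tree obtained from two trees by identifying their roots. -/
def merge (p q : PlaneTree) : PlaneTree := ofList (p.children ++ q.children)

theorem node_zero (c : Fin 0 → PlaneTree) : node 0 c = leaf :=
  congrArg (node 0) (Subsingleton.elim _ _)

@[elab_as_elim]
theorem attach_induction {motive : PlaneTree → Prop} (leaf : motive leaf)
    (attach : ∀ t u, motive t → motive u → motive (attach t u)) : ∀ p, motive p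
  | node n c => by
    have hc : ∀ i, motive (c i) := fun i => attach_induction leaf attach (c i)
    induction n with
    | zero => rwa [node_zero]
    | succ n ih =>
      rw [← Fin.cons_self_tail c]
      exact attach _ _ (hc 0) (ih _ fun i => hc i.succ)

theorem children_attach (t : PlaneTree) : ∀ u, (attach t u).children = t :: u.children
  | node _ c => List.ofFn_cons t c

theorem ofList_cons (t : PlaneTree) (l : List PlaneTree) :
    ofList (t :: l) = attach t (ofList l) := by
  rw [← ofList_children (attach t (ofList l)), children_attach, children_ofList]

theorem merge_leaf_left (q : PlaneTree) : merge leaf q = q := ofList_children q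

theorem merge_attach_left (t u q : PlaneTree) : merge (attach t u) q = attach t (merge u q) := by
  rw [merge, children_attach, List.cons_append, ofList_cons, merge]

theorem order_leaf : leaf.order = 1 := by simp [leaf, order_node]

theorem order_attach (t : PlaneTree) : ∀ u, (attach t u).order = t.order + u.order
  | node n c => order_graftAt t (node n c) none

theorem order_pos : ∀ p : PlaneTree, 0 < p.order
  | node n c => by rw [order_node]; exact Nat.succ_pos _

theorem order_merge_add_one (p q : PlaneTree) : (merge p q).order + 1 = p.order + q.order := by
  induction p using attach_induction with
  | leaf => rw [merge_leaf_left, order_leaf, add_comm]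
  | attach t u _ ihu =>
    rw [merge_attach_left, order_attach, order_attach, add_assoc, ihu, add_assoc]

theorem eq_leaf_of_order_eq_one (p : PlaneTree) (h : p.order = 1) : p = leaf := by
  induction p using attach_induction with
  | leaf => rfl
  | attach t u =>
    have := order_attach t u
    have := t.order_pos
    have := u.order_pos
    omega

/-! ### Spanning subforests -/

/-- A spanning subforest of `attach t u` consists of spanning subforests of `t` and of `u` and of
the choice whether to keep the edge between their roots. -/
def attachSubforest (t : PlaneTree) :
    ∀ u, (Bool × SpanningSubforest t) × SpanningSubforest u ≃ SpanningSubforest (attach t u)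
  | node n c => Fin.consEquiv fun i : Fin (n + 1) =>
      Bool × SpanningSubforest ((Fin.cons t c : Fin (n + 1) → PlaneTree) i)

theorem rootComponent_node_succ {n : ℕ} (c : Fin (n + 1) → PlaneTree)
    (s : SpanningSubforest (node (n + 1) c)) :
    rootComponent (node (n + 1) c) s =
      if (s 0).1 then attach (rootComponent (c 0) (s 0).2)
        (rootComponent (node n fun i => c i.succ) fun i => s i.succ)
      else rootComponent (node n fun i => c i.succ) fun i => s i.succ := by
  cases h : (s 0).1 <;> simp [rootComponent, List.finRange_succ, h,
    List.filter_map, ofList_cons, Function.comp_def]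

theorem contract_node_succ {n : ℕ} (c : Fin (n + 1) → PlaneTree)
    (s : SpanningSubforest (node (n + 1) c)) :
    contract (node (n + 1) c) s =
      if (s 0).1 then merge (contract (c 0) (s 0).2)
        (contract (node n fun i => c i.succ) fun i => s i.succ)
      else attach (contract (c 0) (s 0).2)
        (contract (node n fun i => c i.succ) fun i => s i.succ) := by
  cases h : (s 0).1 <;> simp [contract, List.finRange_succ, h, merge, children_ofList,
    List.flatMap_map, ofList_cons]

theorem otherComponents_node_succ {n : ℕ} (c : Fin (n + 1) → PlaneTree)
    (s : SpanningSubforest (node (n + 1) c)) :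
    otherComponents (node (n + 1) c) s =
      (otherComponents (c 0) (s 0).2 + if (s 0).1 then 0 else {rootComponent (c 0) (s 0).2}) +
        otherComponents (node n fun i => c i.succ) fun i => s i.succ := by
  simp only [otherComponents, Fin.sum_univ_succ]

theorem rootComponent_attach (t : PlaneTree) (b : Bool) (s : SpanningSubforest t) :
    ∀ u (s' : SpanningSubforest u), rootComponent (attach t u) (attachSubforest t u ((b, s), s')) =
      if b then attach (rootComponent t s) (rootComponent u s') else rootComponent u s'
  | node _ c, _ => rootComponent_node_succ (Fin.cons t c) _

theorem contract_attach (t : PlaneTree) (b : Bool) (s : SpanningSubforest t) :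
    ∀ u (s' : SpanningSubforest u), contract (attach t u) (attachSubforest t u ((b, s), s')) =
      if b then merge (contract t s) (contract u s') else attach (contract t s) (contract u s')
  | node _ c, _ => contract_node_succ (Fin.cons t c) _

theorem otherComponents_attach (t : PlaneTree) (b : Bool) (s : SpanningSubforest t) :
    ∀ u (s' : SpanningSubforest u),
      otherComponents (attach t u) (attachSubforest t u ((b, s), s')) =
        (otherComponents t s + if b then 0 else {rootComponent t s}) + otherComponents u s'
  | node _ c, _ => otherComponents_node_succ (Fin.cons t c) _

theorem order_contract_le (p : PlaneTree) :
    ∀ s : SpanningSubforest p, (contract p s).order ≤ p.order := by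
  induction p using attach_induction with
  | leaf => exact fun _ => (congrArg order (node_zero _)).le
  | attach t u iht ihu =>
    refine (attachSubforest t u).forall_congr_right.1 fun ⟨⟨b, s⟩, s'⟩ => ?_
    have := order_merge_add_one (contract t s) (contract u s')
    have := iht s
    have := ihu s'
    rw [contract_attach, order_attach]
    split_ifs
    · omega
    · rw [order_attach]
      omega

section ForestSum

variable {M : Type*} [AddCommMonoid M]

/-- The sum of `Ψ r o q` over the spanning subforests of `p`, where `r` is the root component, `o`
consists of the other components and `q` is the contracted tree. -/
def forestSum (p : PlaneTree) (Ψ : PlaneTree → Multiset PlaneTree → PlaneTree → M) : M :=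
  ∑ s : SpanningSubforest p, Ψ (rootComponent p s) (otherComponents p s) (contract p s)

theorem forestSum_leaf (Ψ : PlaneTree → Multiset PlaneTree → PlaneTree → M) :
    forestSum leaf Ψ = Ψ leaf 0 leaf := by
  have : Unique (SpanningSubforest leaf) :=
    inferInstanceAs (Unique (∀ i : Fin 0, Bool × SpanningSubforest i.elim0))
  rw [forestSum, Fintype.sum_unique]
  exact congrArg₂ (Ψ · 0 ·) (node_zero _) (node_zero _)

theorem forestSum_attach (t u : PlaneTree)
    (Ψ : PlaneTree → Multiset PlaneTree → PlaneTree → M) :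
    forestSum (attach t u) Ψ = forestSum t fun r o q => forestSum u fun r' o' q' =>
      Ψ (attach r r') (o + o') (merge q q') + Ψ r' (r ::ₘ (o + o')) (attach q q') := by
  simp only [forestSum]
  rw [← (attachSubforest t u).sum_comp, Fintype.sum_prod_type, Fintype.sum_prod_type,
    Fintype.sum_bool, ← Finset.sum_add_distrib]
  refine Finset.sum_congr rfl fun s _ => ?_
  rw [← Finset.sum_add_distrib]
  refine Finset.sum_congr rfl fun s' _ => ?_
  simp [rootComponent_attach, contract_attach, otherComponents_attach, add_assoc]

theorem forestSum_congr {p : PlaneTree} {Ψ Φ : PlaneTree → Multiset PlaneTree → PlaneTree → M}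
    (h : ∀ r o q, Ψ r o q = Φ r o q) : forestSum p Ψ = forestSum p Φ :=
  Finset.sum_congr rfl fun _ _ => h _ _ _

theorem forestSum_add (p : PlaneTree) (Ψ Φ : PlaneTree → Multiset PlaneTree → PlaneTree → M) :
    forestSum p (fun r o q => Ψ r o q + Φ r o q) = forestSum p Ψ + forestSum p Φ :=
  Finset.sum_add_distrib

theorem forestSum_comm (p p' : PlaneTree) (Ψ : PlaneTree → Multiset PlaneTree → PlaneTree →
      PlaneTree → Multiset PlaneTree → PlaneTree → M) :
    (forestSum p fun r o q => forestSum p' (Ψ r o q)) =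
      forestSum p' fun r' o' q' => forestSum p fun r o q => Ψ r o q r' o' q' :=
  Finset.sum_comm

theorem sum_map_forestSum {ι : Type*} (m : Multiset ι) (p : PlaneTree)
    (Ψ : ι → PlaneTree → Multiset PlaneTree → PlaneTree → M) :
    (m.map fun i => forestSum p (Ψ i)).sum =
      forestSum p fun r o q => (m.map fun i => Ψ i r o q).sum :=
  Multiset.sum_map_sum

theorem forestSum_contract_eq_leaf (p : PlaneTree) (Ψ : PlaneTree → Multiset PlaneTree → M) :
    (forestSum p fun r o q => if q.order = 1 then Ψ r o else 0) = Ψ p 0 := by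
  induction p using attach_induction generalizing Ψ with
  | leaf => rw [forestSum_leaf, if_pos order_leaf]
  | attach t u iht ihu =>
    have order_merge_eq_one : ∀ q q', (merge q q').order = 1 ↔ q.order = 1 ∧ q'.order = 1 := by
      intro q q'
      have := order_merge_add_one q q'
      have := q.order_pos
      have := q'.order_pos
      omega
    have order_attach_ne_one : ∀ q q', (attach q q').order ≠ 1 := by
      intro q q'
      have := q.order_pos
      have := q'.order_pos
      rw [order_attach]
      omega
    calc (forestSum (attach t u) fun r o q => if q.order = 1 then Ψ r o else 0)
      _ = forestSum t fun r o q => if q.order = 1 then (forestSum u fun r' o' q' =>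
            if q'.order = 1 then Ψ (attach r r') (o + o') else 0) else 0 := by
        rw [forestSum_attach]
        refine forestSum_congr fun r o q => ?_
        split_ifs with hq <;> simp [order_merge_eq_one, order_attach_ne_one, hq, forestSum]
      _ = Ψ (attach t u) 0 := by
        rw [iht fun r o => _, ihu fun r' o' => _, add_zero]

end ForestSum

/-! ### Cutting an edge -/

/-- The tree with all the branches `c` except the `i`-th one. -/
def eraseBranch : {n : ℕ} → (Fin n → PlaneTree) → Fin n → PlaneTree
  | n + 1, c, i => node n (i.removeNth c)

/-- The pairs (branch cut off, remaining tree) obtained by cutting the edges of a tree. -/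
def edgeCuts : PlaneTree → Multiset (PlaneTree × PlaneTree)
  | node n c => ∑ i, ({(c i, eraseBranch c i)} +
      (edgeCuts (c i)).map fun q => (q.1, node n (Function.update c i q.2)))

theorem edgeCuts_leaf : edgeCuts leaf = 0 := rfl

theorem eraseBranch_cons_zero (t : PlaneTree) {n : ℕ} (c : Fin n → PlaneTree) :
    eraseBranch (Fin.cons t c : Fin (n + 1) → PlaneTree) 0 = node n c := rfl

theorem eraseBranch_cons_succ (t : PlaneTree) : ∀ {n : ℕ} (c : Fin n → PlaneTree) (i : Fin n),
    eraseBranch (Fin.cons t c : Fin (n + 1) → PlaneTree) i.succ =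
      attach t (eraseBranch c i)
  | n + 1, c, i => by
    refine congrArg (node (n + 1)) (funext fun j => ?_)
    refine Fin.cases ?_ (fun j => ?_) j <;> simp [Fin.removeNth]

theorem edgeCuts_attach (t : PlaneTree) : ∀ u, edgeCuts (attach t u) =
    {(t, u)} + ((edgeCuts t).map (fun q => (q.1, attach q.2 u)) +
      (edgeCuts u).map fun q => (q.1, attach t q.2))
  | node n c => by
    have attach_node : ∀ d : Fin n → PlaneTree,
        attach t (node n d) = node (n + 1) (Fin.cons t d) := fun _ => rfl
    rw [attach_node, edgeCuts, Fin.sum_univ_succ]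
    simp only [Fin.cons_zero, Fin.cons_succ, eraseBranch_cons_zero, eraseBranch_cons_succ,
      Fin.update_cons_zero, ← Fin.cons_update, ← attach_node]
    rw [edgeCuts, ← Multiset.coe_mapAddMonoidHom fun q : PlaneTree × PlaneTree =>
      (q.1, attach t q.2), map_sum, add_assoc]
    simp [attach]

theorem edgeCuts_merge (p u : PlaneTree) : edgeCuts (merge p u) =
    (edgeCuts p).map (fun q => (q.1, merge q.2 u)) +
      (edgeCuts u).map fun q => (q.1, merge p q.2) := by
  induction p using attach_induction with
  | leaf => simp [merge_leaf_left, edgeCuts_leaf]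
  | attach t p _ ih =>
    simp [merge_attach_left, edgeCuts_attach, ih, add_assoc]

theorem order_add_order_of_mem_edgeCuts {p : PlaneTree} :
    ∀ c ∈ edgeCuts p, c.1.order + c.2.order = p.order := by
  induction p using attach_induction with
  | leaf => simp [edgeCuts_leaf]
  | attach t u iht ihu =>
    simp only [edgeCuts_attach, Multiset.mem_add, Multiset.mem_singleton, Multiset.mem_map]
    rintro _ (rfl | ⟨c, hc, rfl⟩ | ⟨c, hc, rfl⟩)
    · rw [order_attach]
    · rw [order_attach, order_attach, ← iht c hc, add_assoc]
    · rw [order_attach, order_attach, ← ihu c hc, add_left_comm]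

theorem sum_edgeCuts_contract {M : Type*} [AddCommMonoid M] (p : PlaneTree)
    (Ψ : PlaneTree → Multiset PlaneTree → PlaneTree × PlaneTree → M) :
    (forestSum p fun r o q => ((edgeCuts q).map (Ψ r o)).sum) =
      ((edgeCuts p).map fun c => forestSum c.1 fun r o q => forestSum c.2 fun r' o' q' =>
        Ψ r' (r ::ₘ (o + o')) (q, q')).sum := by
  induction p using attach_induction generalizing Ψ with
  | leaf => simp [forestSum_leaf, edgeCuts_leaf]
  | attach t u iht ihu =>
    let G (r : PlaneTree) (o : Multiset PlaneTree) (c : PlaneTree × PlaneTree) : M :=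
      forestSum u fun r' o' q' => Ψ (attach r r') (o + o') (c.1, merge c.2 q') +
        Ψ r' (r ::ₘ (o + o')) (c.1, attach c.2 q')
    let H (r' : PlaneTree) (o' : Multiset PlaneTree) (c : PlaneTree × PlaneTree) : M :=
      forestSum t fun r o q => Ψ (attach r r') (o + o') (c.1, merge q c.2) +
        Ψ r' (r ::ₘ (o + o')) (c.1, attach q c.2)
    calc forestSum (attach t u) (fun r o q => ((edgeCuts q).map (Ψ r o)).sum)
      _ = (forestSum t fun r o q => forestSum u fun r' o' q' => Ψ r' (r ::ₘ (o + o')) (q, q')) +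
          ((forestSum t fun r o q => ((edgeCuts q).map (G r o)).sum) +
            forestSum u fun r' o' q' => ((edgeCuts q').map (H r' o')).sum) := by
        simp only [G, H, sum_map_forestSum, forestSum_comm u t, ← forestSum_add]
        rw [forestSum_attach]
        refine forestSum_congr fun r o q => forestSum_congr fun r' o' q' => ?_
        simp only [edgeCuts_attach, edgeCuts_merge, Multiset.map_add, Multiset.sum_add,
          Multiset.map_map, Function.comp_def, Multiset.map_singleton, Multiset.sum_singleton,
          Multiset.sum_map_add]
        abel
      _ = _ := by
        rw [iht, ihu, edgeCuts_attach]
        simp only [Multiset.map_add, Multiset.sum_add, Multiset.map_map, Function.comp_def,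
          Multiset.map_singleton, Multiset.sum_singleton, forestSum_attach, G, H]
        congr 2
        · simp [add_assoc, Multiset.cons_swap]
        · refine congrArg Multiset.sum (Multiset.map_congr rfl fun c _ => ?_)
          refine forestSum_congr fun r o q => ?_
          rw [forestSum_comm]
          simp [add_left_comm, Multiset.cons_swap]

end PlaneTree

/-! ### Counting isomorphisms -/

theorem sum_equiv_fin_succ {M : Type*} [AddCommMonoid M] {n m : ℕ}
    (f : (Fin (n + 1) ≃ Fin (m + 1)) → M) :
    ∑ e, f e = ∑ j, ∑ e : Fin n ≃ Fin m,
      f ((finSuccEquiv n).trans (e.optionCongr.trans (finSuccEquiv' j).symm)) := by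
  rw [← Fintype.sum_prod_type', eq_comm]
  refine Fintype.sum_bijective _ ⟨?_, fun e => ?_⟩ _ _ fun _ => rfl
  · rintro ⟨j, e⟩ ⟨j', e'⟩ h
    obtain rfl : j = j' := by simpa using Equiv.congr_fun h 0
    exact Prod.ext rfl (Equiv.ext fun i => by simpa using Equiv.congr_fun h i.succ)
  · let g := ((finSuccEquiv n).symm.trans e).trans (finSuccEquiv' (e 0))
    have hg : (Equiv.removeNone g).optionCongr = g := by
      ext1 (_ | i)
      · simp [g]
      · refine Equiv.removeNone_some g (Option.ne_none_iff_exists'.1 fun h => ?_)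
        simp [g, finSuccEquiv'_eq_none, Fin.ext_iff] at h
    exact ⟨(e 0, Equiv.removeNone g), by ext1 i; simp [hg, g]⟩

namespace PlaneTree

theorem sum_map_edgeCuts_node {M : Type*} [AddCommMonoid M] {n : ℕ} (c : Fin n → PlaneTree)
    (f : PlaneTree × PlaneTree → M) :
    ((edgeCuts (node n c)).map f).sum = ∑ i, (f (c i, eraseBranch c i) +
      ((edgeCuts (c i)).map fun p => f (p.1, node n (Function.update c i p.2))).sum) := by
  rw [edgeCuts, ← Multiset.coe_mapAddMonoidHom, map_sum, Multiset.sum_sum]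
  simp

/-- The number of isomorphisms between two rooted trees. -/
noncomputable def isoCount (p q : PlaneTree) : ℕ := Nat.card (Iso p q)

theorem isoCount_node {n m : ℕ} (c : Fin n → PlaneTree) (d : Fin m → PlaneTree) :
    isoCount (node n c) (node m d) = ∑ e : Fin n ≃ Fin m, ∏ i, isoCount (c i) (d (e i)) := by
  change Nat.card (Σ e : Fin n ≃ Fin m, ∀ i, Iso (c i) (d (e i))) = _
  rw [Nat.card_sigma]
  exact Finset.sum_congr rfl fun _ _ => Nat.card_pi

theorem isoCount_congr_left : ∀ p p' q : PlaneTree, Nonempty (Iso p p') →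
    isoCount p q = isoCount p' q
  | node n c, node n' c', node m d, ⟨⟨e, f⟩⟩ => by
    rw [isoCount_node, isoCount_node]
    refine Fintype.sum_equiv (e.equivCongr (Equiv.refl (Fin m))) _ _ fun g => ?_
    refine Fintype.prod_equiv e _ _ fun i => ?_
    rw [isoCount_congr_left (c i) (c' (e i)) _ ⟨f i⟩]
    simp

theorem isoCount_comm : ∀ p q : PlaneTree, isoCount p q = isoCount q p
  | node n c, node m d => by
    rw [isoCount_node, isoCount_node]
    refine Fintype.sum_equiv ⟨Equiv.symm, Equiv.symm, fun _ => rfl, fun _ => rfl⟩ _ _ fun e => ?_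
    refine Fintype.prod_equiv e _ _ fun i => ?_
    rw [isoCount_comm (c i)]
    simp

theorem isoCount_attach_node (t : PlaneTree) {m : ℕ} (d : Fin m → PlaneTree) :
    ∀ u, isoCount (attach t u) (node m d) = ∑ j, isoCount t (d j) * isoCount u (eraseBranch d j)
  | node n c => by
    cases m with
    | zero =>
      have : IsEmpty (Fin (n + 1) ≃ Fin 0) := ⟨fun e => (e 0).elim0⟩
      rw [attach, isoCount_node, Finset.univ_eq_empty, Finset.sum_empty, Finset.univ_eq_empty,
        Finset.sum_empty]
    | succ m =>
      rw [attach, isoCount_node, sum_equiv_fin_succ]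
      refine Finset.sum_congr rfl fun j _ => ?_
      rw [eraseBranch, isoCount_node, Finset.mul_sum]
      refine Finset.sum_congr rfl fun e _ => ?_
      simp [Fin.prod_univ_succ, Fin.removeNth]

theorem prod_isoCount_update_left {n m : ℕ} (c : Fin n → PlaneTree) (d : Fin m → PlaneTree)
    (e : Fin n ≃ Fin m) (i : Fin n) (p : PlaneTree) :
    ∏ l, isoCount (Function.update c i p l) (d (e l)) =
      isoCount p (d (e i)) * ∏ l ∈ Finset.univ.erase i, isoCount (c l) (d (e l)) := by
  rw [← Finset.mul_prod_erase _ _ (Finset.mem_univ i), Function.update_self]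
  congr 1
  refine Finset.prod_congr rfl fun l hl => ?_
  rw [Function.update_of_ne (Finset.ne_of_mem_erase hl)]

theorem prod_isoCount_update_right {n m : ℕ} (c : Fin n → PlaneTree) (d : Fin m → PlaneTree)
    (e : Fin n ≃ Fin m) (i : Fin n) (p : PlaneTree) :
    ∏ l, isoCount (c l) (Function.update d (e i) p (e l)) =
      isoCount (c i) p * ∏ l ∈ Finset.univ.erase i, isoCount (c l) (d (e l)) := by
  rw [← Finset.mul_prod_erase _ _ (Finset.mem_univ i), Function.update_self]
  congr 1
  refine Finset.prod_congr rfl fun l hl => ?_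
  rw [Function.update_of_ne (e.injective.ne (Finset.ne_of_mem_erase hl))]

theorem sum_isoCount_graftAt (t : PlaneTree) : ∀ u q : PlaneTree,
    ∑ w : u.Vertex, isoCount (graftAt t u w) q =
      ((edgeCuts q).map fun p => isoCount t p.1 * isoCount u p.2).sum
  | node n c, node m d => by
    have sum_vertex : ∑ w : (node n c).Vertex, isoCount (graftAt t (node n c) w) (node m d) =
        isoCount (attach t (node n c)) (node m d) + ∑ i, ∑ w : (c i).Vertex,
          isoCount (node n (Function.update c i (graftAt t (c i) w))) (node m d) := by
      rw [← Fintype.sum_sigma']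
      exact Fintype.sum_option (α := Σ i : Fin n, (c i).Vertex)
        fun w => isoCount (graftAt t (node n c) w) (node m d)
    let cutBranch (e : Fin n ≃ Fin m) (j : Fin m) : ℕ := ((edgeCuts (d j)).map fun p =>
      isoCount t p.1 * ∏ l, isoCount (c l) (Function.update d j p.2 (e l))).sum
    have sum_branch : ∀ i, ∑ w : (c i).Vertex,
          isoCount (node n (Function.update c i (graftAt t (c i) w))) (node m d) =
        ∑ e : Fin n ≃ Fin m, cutBranch e (e i) := by
      intro i
      simp only [isoCount_node, prod_isoCount_update_left, prod_isoCount_update_right, cutBranch]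
      rw [Finset.sum_comm]
      refine Finset.sum_congr rfl fun e _ => ?_
      rw [← Finset.sum_mul, sum_isoCount_graftAt t (c i) (d (e i)), ← Multiset.sum_map_mul_right]
      simp only [mul_assoc]
    have sum_cutBranch : ∀ j, ∑ e, cutBranch e j = ((edgeCuts (d j)).map fun p =>
        isoCount t p.1 * isoCount (node n c) (node m (Function.update d j p.2))).sum := by
      intro j
      simp only [cutBranch, isoCount_node, Finset.mul_sum, Multiset.sum_map_sum]
    rw [sum_vertex, isoCount_attach_node, sum_map_edgeCuts_node, Finset.sum_add_distrib]
    simp only [sum_branch, ← sum_cutBranch]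
    rw [Finset.sum_comm, Finset.sum_comm (s := (Finset.univ : Finset (Fin m)))]
    simp only [Equiv.sum_comp]

theorem order_eq_of_iso : ∀ p q : PlaneTree, Nonempty (Iso p q) → p.order = q.order
  | node n c, node m d, ⟨⟨e, f⟩⟩ => by
    rw [order_node, order_node]
    have h : ∑ i, order (c i) = ∑ j, order (d j) := Fintype.sum_equiv e _ _
      fun i => order_eq_of_iso (c i) (d (e i)) ⟨f i⟩
    rw [h]

end PlaneTree

namespace RTree

open PlaneTree

theorem order_mk (p : PlaneTree) : (mk p).order = p.order :=
  order_eq_of_iso _ _ (mk_eq_mk.1 (mk_rep _))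

/-! ### Independence of the plane representative -/

/-- The branches at the root of a plane tree, regarded as non-planar trees. They determine the
underlying non-planar tree. -/
def branches (p : PlaneTree) : Multiset RTree := (p.children.map mk : List RTree)

theorem branches_attach (t u : PlaneTree) : branches (attach t u) = {mk t} + branches u := by
  simp [branches, children_attach]

theorem branches_merge (p q : PlaneTree) : branches (merge p q) = branches p + branches q := by
  simp [branches, merge, children_ofList]

theorem branches_node : ∀ {n : ℕ} (c : Fin n → PlaneTree), branches (node n c) = ∑ i, {mk (c i)}
  | 0, _ => rfl
  | n + 1, c => by
    rw [Fin.sum_univ_succ, ← branches_node, ← branches_attach]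
    exact congrArg (fun c => branches (node (n + 1) c)) (Fin.cons_self_tail c).symm

theorem branches_rootComponent : ∀ {n : ℕ} (c : Fin n → PlaneTree)
    (s : SpanningSubforest (node n c)), branches (rootComponent (node n c) s) =
      ∑ i, if (s i).1 then {mk (rootComponent (c i) (s i).2)} else 0
  | 0, _, _ => rfl
  | n + 1, c, s => by
    have ih := branches_rootComponent (fun i => c i.succ) fun i => s i.succ
    rw [rootComponent_node_succ, Fin.sum_univ_succ]
    split_ifs <;> simp [ih, branches_attach]

theorem branches_contract : ∀ {n : ℕ} (c : Fin n → PlaneTree)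
    (s : SpanningSubforest (node n c)), branches (contract (node n c) s) =
      ∑ i, if (s i).1 then branches (contract (c i) (s i).2) else {mk (contract (c i) (s i).2)}
  | 0, _, _ => rfl
  | n + 1, c, s => by
    have ih := branches_contract (fun i => c i.succ) fun i => s i.succ
    rw [contract_node_succ, Fin.sum_univ_succ]
    split_ifs <;> simp [ih, branches_attach, branches_merge]

theorem mk_ofList_congr {a b : List PlaneTree} (h : (a.map mk).Perm (b.map mk)) :
    mk (ofList a) = mk (ofList b) := by
  classical
  let e : Fin a.length ≃ Fin b.length := (finCongr (List.length_map mk).symm).trans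
    ((Equiv.ofBijective h.idxBij ⟨h.idxBij_injective, h.idxBij_surjective⟩).trans
      (finCongr (List.length_map mk)))
  refine mk_node e fun i => ?_
  have := h.getElem_idxBij_eq_getElem (finCongr (List.length_map mk).symm i)
  rw [List.getElem_map, List.getElem_map] at this
  exact this.symm

theorem mk_eq_mk_iff_branches_eq {p q : PlaneTree} : mk p = mk q ↔ branches p = branches q := by
  refine ⟨fun h => ?_, fun h => ?_⟩
  · obtain ⟨n, c⟩ := p
    obtain ⟨m, d⟩ := q
    obtain ⟨⟨e, f⟩⟩ := mk_eq_mk.1 h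
    rw [branches_node, branches_node]
    exact Fintype.sum_equiv e _ _ fun i => congrArg _ (mk_eq_mk.2 ⟨f i⟩)
  · rw [← ofList_children p, ← ofList_children q]
    exact mk_ofList_congr (Multiset.coe_eq_coe.1 h)

theorem exists_subforest_equiv : ∀ p q : PlaneTree, mk p = mk q →
    ∃ e : SpanningSubforest p ≃ SpanningSubforest q, ∀ s,
      mk (rootComponent p s) = mk (rootComponent q (e s)) ∧
      (otherComponents p s).map mk = (otherComponents q (e s)).map mk ∧
      mk (contract p s) = mk (contract q (e s))
  | node n c, node m d, h => by
    obtain ⟨⟨e, f⟩⟩ := mk_eq_mk.1 h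
    choose E root others contr using
      fun i => exists_subforest_equiv (c i) (d (e i)) (mk_eq_mk.2 ⟨f i⟩)
    let F : SpanningSubforest (node n c) ≃ SpanningSubforest (node m d) :=
      e.piCongr fun i => (Equiv.refl Bool).prodCongr (E i)
    have F_apply : ∀ s i, F s (e i) = ((s i).1, E i (s i).2) := fun s i =>
      Equiv.piCongr_apply_apply _ _ _ _
    refine ⟨F, fun s => ⟨?_, ?_, ?_⟩⟩
    · rw [mk_eq_mk_iff_branches_eq, branches_rootComponent, branches_rootComponent]
      exact Fintype.sum_equiv e _ _ fun i => by rw [F_apply, root]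
    · rw [otherComponents, otherComponents, ← Multiset.coe_mapAddMonoidHom, map_sum, map_sum]
      refine Fintype.sum_equiv e _ _ fun i => ?_
      rw [F_apply, map_add, map_add]
      simp only [Multiset.coe_mapAddMonoidHom]
      rw [others]
      split_ifs
      · rfl
      · rw [Multiset.map_singleton, Multiset.map_singleton, root]
    · rw [mk_eq_mk_iff_branches_eq, branches_contract, branches_contract]
      exact Fintype.sum_equiv e _ _ fun i => by
        rw [F_apply, contr, mk_eq_mk_iff_branches_eq.1 (contr i _)]

theorem isoCount_rep_mk (t : RTree) (p : PlaneTree) :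
    isoCount t.rep p = isoCount t.rep (mk p).rep := by
  rw [isoCount_comm, isoCount_comm t.rep,
    isoCount_congr_left p _ _ (mk_eq_mk.1 (mk_rep (mk p)).symm)]

theorem symmetryFactor_ne_zero (t : RTree) : t.symmetryFactor ≠ 0 :=
  have := Iso.refl t.rep
  Nat.card_pos.ne'

theorem isoCount_rep_rep (t u : RTree) [Decidable (t = u)] :
    isoCount t.rep u.rep = if t = u then t.symmetryFactor else 0 := by
  split_ifs with h
  · rw [← h]
    rfl
  · have : IsEmpty (Iso t.rep u.rep) := ⟨fun e => h (by
      rw [← mk_rep t, ← mk_rep u, mk_eq_mk]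
      exact ⟨e⟩)⟩
    exact Nat.card_of_isEmpty

theorem order_leaf : leaf.order = 1 := (order_mk _).trans PlaneTree.order_leaf

theorem symmetryFactor_leaf : leaf.symmetryFactor = 1 := by
  have : leaf.rep = PlaneTree.leaf := PlaneTree.eq_leaf_of_order_eq_one _ order_leaf
  change isoCount leaf.rep leaf.rep = 1
  rw [this, PlaneTree.leaf, isoCount_node]
  simp

/-- The relation `h = f g` for the product of functions on rooted trees that is dual to cutting one
edge: `h(t)` is the sum of `f(b) g(r)` over the ways of cutting an edge of `t` into a branch `b` and
a remaining tree `r`. It is a relation since the sum is computed on plane representatives. -/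
def IsCutProduct {R : Type*} [NonUnitalNonAssocSemiring R] (f g h : RTree → R) : Prop :=
  ∀ p, h (mk p) = ((edgeCuts p).map fun c => f (mk c.1) * g (mk c.2)).sum

/-! ### Substitution of functions on rooted trees -/

section Substitution

variable {R : Type*} [CommSemiring R]

/-- The substitution `f ↦ α ⋆ f` of functions on rooted trees: `(α ⋆ f)(t)` is the sum of
`α(s) f(t / s)` over the spanning subforests `s` of `t`, where `α` is extended multiplicatively to
forests. -/
noncomputable def substitution (α : RTree → R) : (RTree → R) →ₗ[R] RTree → R where
  toFun f t := forestSum t.rep fun r o q => ((r ::ₘ o).map fun c => α (mk c)).prod * f (mk q)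
  map_add' f g := by
    ext t
    simp [forestSum, mul_add, Finset.sum_add_distrib]
  map_smul' a f := by
    ext t
    simp [forestSum, Finset.mul_sum, mul_left_comm]

theorem substitution_mk (α f : RTree → R) (p : PlaneTree) : substitution α f (mk p) =
    forestSum p fun r o q => ((r ::ₘ o).map fun c => α (mk c)).prod * f (mk q) := by
  obtain ⟨e, he⟩ := exists_subforest_equiv (mk p).rep p (mk_rep (mk p))
  refine Fintype.sum_equiv e _ _ fun s => ?_
  obtain ⟨root, others, contr⟩ := he s
  have others_map := congrArg (fun m : Multiset RTree => (m.map α).prod) others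
  simp only [Multiset.map_map, Function.comp_def] at others_map
  simp only [Multiset.map_cons, Multiset.prod_cons, root, others_map, contr]

theorem substitution_congr (α : RTree → R) {f g : RTree → R} {t : RTree}
    (h : ∀ u : RTree, u.order ≤ t.order → f u = g u) :
    substitution α f t = substitution α g t := by
  refine Finset.sum_congr rfl fun s _ => ?_
  exact congrArg (_ * ·) (h _ ((order_mk _).trans_le (order_contract_le _ s)))

theorem IsCutProduct.substitution (α : RTree → R) {f g h : RTree → R} (hfgh : IsCutProduct f g h) :
    IsCutProduct (substitution α f) (substitution α g) (substitution α h) := by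
  intro p
  simp only [substitution_mk, hfgh _, ← Multiset.sum_map_mul_left]
  rw [sum_edgeCuts_contract]
  refine congrArg Multiset.sum (Multiset.map_congr rfl fun c _ => ?_)
  simp only [forestSum, Finset.sum_mul_sum]
  refine Finset.sum_congr rfl fun s _ => Finset.sum_congr rfl fun s' _ => ?_
  simp only [Multiset.map_cons, Multiset.map_add, Multiset.prod_cons, Multiset.prod_add]
  ring

end Substitution

end RTree

/-! ### The pairing on the space of rooted trees -/

namespace TreeSpace

open PlaneTree RTree

variable {k : Type*} [Field k]

/-- The symmetric bilinear pairing `⟨t, u⟩ = σ(t) δ_{t, u}`, as a map from `T` to the functions on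
rooted trees. The value `⟨t, u⟩` is the number of isomorphisms from `t` to `u`. -/
noncomputable def pairing : TreeSpace k →ₗ[k] RTree → k :=
  Finsupp.linearCombination k fun t u => (isoCount t.rep u.rep : k)

theorem pairing_tree_mk (t : RTree) (p : PlaneTree) :
    pairing (tree k t) (mk p) = isoCount t.rep p := by
  simp [pairing, tree, isoCount_rep_mk t p]

theorem pairing_tree_apply (t u : RTree) [Decidable (t = u)] :
    pairing (tree k t) u = if t = u then (t.symmetryFactor : k) else 0 := by
  simp [pairing, tree, isoCount_rep_rep]

theorem pairing_leaf_mk (p : PlaneTree) :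
    pairing (tree k RTree.leaf) (mk p) = if p.order = 1 then 1 else 0 := by
  classical
  have : RTree.leaf = mk p ↔ p.order = 1 := by
    refine ⟨fun h => ?_, fun h => ?_⟩
    · rw [← order_mk, ← h, RTree.order_leaf]
    · rw [eq_leaf_of_order_eq_one p h]
      rfl
  simp [pairing_tree_apply, this, symmetryFactor_leaf]

theorem pairing_graft_tree_tree_mk (t u : RTree) (p : PlaneTree) :
    pairing (graft k (tree k t) (tree k u)) (mk p) =
      ∑ w : u.rep.Vertex, (isoCount (graftAt t.rep u.rep w) p : k) := by
  rw [graft_tree, graftTree, map_sum, Finset.sum_apply]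
  refine Finset.sum_congr rfl fun w _ => ?_
  rw [pairing_tree_mk, isoCount_congr_left _ _ _ (mk_eq_mk.1 (mk_rep _))]

theorem isCutProduct_pairing (x y : TreeSpace k) :
    IsCutProduct (pairing x) (pairing y) (pairing (graft k x y)) := by
  intro p
  induction x using Finsupp.induction_linear with
  | zero => simp
  | add x x' hx hx' => simp [add_mul, Multiset.sum_map_add, hx, hx']
  | single t r =>
  induction y using Finsupp.induction_linear with
  | zero => simp
  | add y y' hy hy' => simp [mul_add, Multiset.sum_map_add, hy, hy']
  | single u r' =>
    have sum_isoCount : pairing (graft k (tree k t) (tree k u)) (mk p) =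
        ((edgeCuts p).map fun c =>
          pairing (tree k t) (mk c.1) * pairing (tree k u) (mk c.2)).sum := by
      simp only [pairing_graft_tree_tree_mk, pairing_tree_mk, ← Nat.cast_sum,
        sum_isoCount_graftAt, Nat.cast_multiset_sum, Multiset.map_map, Function.comp_def,
        Nat.cast_mul]
    have single_eq (v : RTree) (s : k) : Finsupp.single v s = s • tree k v := by simp [tree]
    simp only [single_eq, map_smul, LinearMap.smul_apply, Pi.smul_apply, sum_isoCount,
      smul_eq_mul, ← Multiset.sum_map_mul_left]
    exact congrArg Multiset.sum (Multiset.map_congr rfl fun c _ => by ring)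

theorem substitution_pairing_leaf (α : RTree → k) :
    substitution α (pairing (tree k RTree.leaf)) = α := by
  ext t
  rw [← mk_rep t, substitution_mk]
  simp only [pairing_leaf_mk, mul_ite, mul_one, mul_zero]
  rw [forestSum_contract_eq_leaf t.rep fun r o => ((r ::ₘ o).map fun c => α (mk c)).prod]
  simp

/-- The element `∑ t, f(t) / σ(t) t` of `T`, where `t` runs over the trees with at most `n`
vertices. On these trees, the pairing with it is `f`. -/
noncomputable def truncatedDual (n : ℕ) (f : RTree → k) : TreeSpace k :=
  ∑ m ∈ Finset.range (n + 1), ∑ t ∈ ofOrder m, (f t / t.symmetryFactor) • tree k t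

theorem pairing_truncatedDual [CharZero k] {n : ℕ} (f : RTree → k) {t : RTree}
    (ht : t.order ≤ n) : pairing (truncatedDual n f) t = f t := by
  classical
  have hσ : (t.symmetryFactor : k) ≠ 0 := Nat.cast_ne_zero.2 t.symmetryFactor_ne_zero
  simp only [truncatedDual, map_sum, map_smul, Finset.sum_apply, Pi.smul_apply,
    pairing_tree_apply, smul_eq_mul, mul_ite, mul_zero, Finset.sum_ite_eq', mem_ofOrder]
  rw [Finset.sum_ite_eq, if_pos (Finset.mem_range_succ_iff.2 ht), div_mul_cancel₀ _ hσ]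

end TreeSpace

namespace ForestAlgebra

variable {k : Type*} [Field k]

theorem convolution_X (α β : Module.Dual k (TreeSpace k)) (t : RTree) :
    convolution (character α).toLinearMap (infinitesimalCharacter β) (MvPolynomial.X t) =
      RTree.substitution (fun u => α (TreeSpace.tree k u)) (fun u => β (TreeSpace.tree k u)) t := by
  simp only [convolution, coproduct, LinearMap.comp_apply, AlgHom.toLinearMap_apply,
    MvPolynomial.aeval_X, treeCoproduct, map_sum, TensorProduct.map_tmul,
    infinitesimalCharacter_X, LinearMap.mul'_apply]
  refine Finset.sum_congr rfl fun s _ => ?_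
  simp [forest, character, PlaneTree.components, map_multiset_prod]

theorem convolution_one (α β : Module.Dual k (TreeSpace k)) :
    convolution (character α).toLinearMap (infinitesimalCharacter β) 1 = 0 := by
  have infinitesimalCharacter_one : infinitesimalCharacter β 1 = 0 := by
    simpa using infinitesimalCharacter_monomial β 0
  simp [convolution, Algebra.TensorProduct.one_def, infinitesimalCharacter_one]

theorem restrict_convolution_one (α β : Module.Dual k (TreeSpace k)) :
    restrict (convolution (character α).toLinearMap (infinitesimalCharacter β)) (0, 1) = 0 := by
  simp [restrict, convolution_one]

theorem restrict_convolution_tree (α β : Module.Dual k (TreeSpace k)) (t : RTree) :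
    restrict (convolution (character α).toLinearMap (infinitesimalCharacter β))
        (TreeSpace.tree k t, 0) =
      RTree.substitution (fun u => α (TreeSpace.tree k u)) (fun u => β (TreeSpace.tree k u)) t := by
  simp [restrict, TreeSpace.tree, convolution_X]

end ForestAlgebra

/-! ### Series indexed by rooted trees -/

section TreeSeries

open PlaneTree RTree TreeSpace

variable {k : Type*} [Field k] {A : Type*} [LeftPreLieRing A] [LeftPreLieAlgebra k A]

theorem elementaryDifferential_graft (a : A) (x y : TreeSpace k) :
    elementaryDifferential k a (graft k x y) =
      elementaryDifferential k a x * elementaryDifferential k a y :=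
  (elementaryDifferential_spec k a).1 x y

theorem treeMorphism_eq_elementaryDifferential {a : A} {F : TreeSpace k →ₗ[k] A}
    (graft_tree : ∀ t u, F (graft k (tree k t) (tree k u)) = F (tree k t) * F (tree k u))
    (leaf : F (tree k leaf) = a) : F = elementaryDifferential k a := by
  refine treeMorphism_ext ⟨fun x y => ?_, leaf⟩ (elementaryDifferential_spec k a)
  have : (graft k).compr₂ F = (LinearMap.mul k A).compl₁₂ F F := by
    ext t u
    exact graft_tree t u
  exact LinearMap.congr_fun₂ this x y

variable (k) in
theorem elementaryDifferential_centroidHom (μ : CentroidHom A) (a : A) (t : RTree) :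
    elementaryDifferential k (μ a) (tree k t) =
      (μ ^ t.order) (elementaryDifferential k a (tree k t)) := by
  let F : TreeSpace k →ₗ[k] A := Finsupp.linearCombination k fun u =>
    (μ ^ u.order) (elementaryDifferential k a (tree k u))
  have F_tree (u : RTree) : F (tree k u) =
      (μ ^ u.order) (elementaryDifferential k a (tree k u)) := by simp [F, tree]
  have : F = elementaryDifferential k (μ a) := by
    refine treeMorphism_eq_elementaryDifferential (fun t u => ?_) ?_
    · calc F (graft k (tree k t) (tree k u))
        _ = (μ ^ (t.order + u.order))
            (elementaryDifferential k a (graft k (tree k t) (tree k u))) := by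
          rw [graft_tree, graftTree]
          simp only [map_sum, F_tree, order_mk, order_graftAt]
          rfl
        _ = F (tree k t) * F (tree k u) := by
          rw [elementaryDifferential_graft, F_tree, F_tree, pow_add, CentroidHom.mul_apply,
            CentroidHomClass.map_mul_left, CentroidHomClass.map_mul_right]
    · rw [F_tree, RTree.order_leaf, pow_one, (elementaryDifferential_spec k a).2]
  rw [← this, F_tree]

/-- The series `∑ t, h ^ v(t) f(t) / σ(t) F_a(t)`, linear in the function `f` on rooted trees. -/
noncomputable def treeSeries (a : A) : (RTree → k) →ₗ[k] HahnSeries ℕ A where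
  toFun f := formalSeries fun n => ∑ t ∈ ofOrder n,
    (f t / t.symmetryFactor) • elementaryDifferential k a (tree k t)
  map_add' f g := by
    ext n
    simp [add_div, add_smul, Finset.sum_add_distrib]
  map_smul' r f := by
    ext n
    simp [mul_div_assoc, mul_smul, Finset.smul_sum]

theorem coeff_treeSeries (a : A) (f : RTree → k) (n : ℕ) : (treeSeries a f).coeff n =
    ∑ t ∈ ofOrder n, (f t / t.symmetryFactor) • elementaryDifferential k a (tree k t) :=
  rfl

theorem coeff_treeSeries_congr (a : A) {f g : RTree → k} {n : ℕ}
    (h : ∀ t : RTree, t.order = n → f t = g t) :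
    (treeSeries a f).coeff n = (treeSeries a g).coeff n := by
  rw [coeff_treeSeries, coeff_treeSeries]
  exact Finset.sum_congr rfl fun t ht => by rw [h t (mem_ofOrder.1 ht)]

theorem treeSeries_pairing_tree [CharZero k] (a : A) (t : RTree) :
    treeSeries a (pairing (tree k t)) =
      HahnSeries.single t.order (elementaryDifferential k a (tree k t)) := by
  classical
  have hσ : (t.symmetryFactor : k) ≠ 0 := Nat.cast_ne_zero.2 t.symmetryFactor_ne_zero
  ext n
  simp only [coeff_treeSeries, pairing_tree_apply, ite_div, zero_div, ite_smul, zero_smul,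
    Finset.sum_ite_eq, mem_ofOrder, div_self hσ, one_smul, HahnSeries.coeff_single, eq_comm]
  split_ifs <;> rfl

theorem treeSeries_pairing_graft [CharZero k] (a : A) (x y : TreeSpace k) :
    treeSeries a (pairing (graft k x y)) =
      treeSeries a (pairing x) * treeSeries a (pairing y) := by
  have h : (graft k).compr₂ (treeSeries a ∘ₗ pairing) =
      (LinearMap.mul k (HahnSeries ℕ A)).compl₁₂ (treeSeries a ∘ₗ pairing)
        (treeSeries a ∘ₗ pairing) := by
    ext t u : 4
    change treeSeries a (pairing (graft k (tree k t) (tree k u))) =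
      treeSeries a (pairing (tree k t)) * treeSeries a (pairing (tree k u))
    rw [treeSeries_pairing_tree, treeSeries_pairing_tree, HahnSeries.single_mul_single,
      ← elementaryDifferential_graft, graft_tree, graftTree]
    simp only [map_sum, treeSeries_pairing_tree, order_mk, order_graftAt]
    exact (map_sum (HahnSeries.single.addMonoidHom _) _ _).symm
  exact LinearMap.congr_fun₂ h x y

theorem treeSeries_mul [CharZero k] (a : A) {f g h : RTree → k} (hfgh : IsCutProduct f g h) :
    treeSeries a f * treeSeries a g = treeSeries a h := by
  ext n
  have pairing_graft (t : RTree) (ht : t.order = n) :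
      pairing (graft k (truncatedDual n f) (truncatedDual n g)) t = h t := by
    rw [← mk_rep t, isCutProduct_pairing, hfgh]
    refine congrArg Multiset.sum (Multiset.map_congr rfl fun c hc => ?_)
    have : c.1.order + c.2.order = n := (order_add_order_of_mem_edgeCuts c hc).trans ht
    rw [pairing_truncatedDual, pairing_truncatedDual] <;> rw [order_mk] <;> omega
  have coeff_eq (f : RTree → k) (i : ℕ) (hi : i ≤ n) :
      (treeSeries a f).coeff i = (treeSeries a (pairing (truncatedDual n f))).coeff i :=
    coeff_treeSeries_congr a fun t ht => (pairing_truncatedDual f (ht.trans_le hi)).symm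
  rw [← coeff_treeSeries_congr a pairing_graft, treeSeries_pairing_graft,
    FormalSeries.coeff_mul, FormalSeries.coeff_mul]
  refine Finset.sum_congr rfl fun i hi => ?_
  have : i.1 + i.2 = n := Finset.HasAntidiagonal.mem_antidiagonal.1 hi
  rw [coeff_eq f i.1 (by omega), coeff_eq g i.2 (by omega)]

theorem elementaryDifferential_treeSeries [CharZero k] (a : A) (α : RTree → k) :
    elementaryDifferential k (treeSeries a α) =
      treeSeries a ∘ₗ substitution α ∘ₗ pairing := by
  refine (treeMorphism_eq_elementaryDifferential (fun t u => ?_) ?_).symm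
  · exact (treeSeries_mul a ((isCutProduct_pairing _ _).substitution α)).symm
  · exact congrArg (treeSeries a) (substitution_pairing_leaf α)

end TreeSeries

section MulH

variable {A : Type*} [NonUnitalNonAssocRing A]

/-- The multiplication by `h` on `A[[h]]`. -/
def mulH : CentroidHom (HahnSeries ℕ A) where
  toFun x := formalSeries fun
    | 0 => 0
    | n + 1 => x.coeff n
  map_zero' := by
    ext (_ | n) <;> rfl
  map_add' x y := by
    ext (_ | n)
    · exact (add_zero 0).symm
    · rfl
  map_mul_left' x y := by
    ext (_ | n)
    · simp [FormalSeries.coeff_mul]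
    · simp [FormalSeries.coeff_mul, Finset.Nat.sum_antidiagonal_succ']
  map_mul_right' x y := by
    ext (_ | n)
    · simp [FormalSeries.coeff_mul]
    · simp [FormalSeries.coeff_mul, Finset.Nat.sum_antidiagonal_succ]

theorem mulH_divH {x : HahnSeries ℕ A} (hx : x.coeff 0 = 0) : mulH (divH x) = x := by
  ext (_ | n)
  · exact hx.symm
  · rfl

theorem coeff_mulH_pow (x : HahnSeries ℕ A) (m n : ℕ) :
    ((mulH ^ m : CentroidHom (HahnSeries ℕ A)) x).coeff (m + n) = x.coeff n := by
  induction m with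
  | zero => simp
  | succ m ih =>
    rw [pow_succ', CentroidHom.mul_apply, add_right_comm, ← ih]
    rfl

end MulH

section BSeries

open RTree TreeSpace

variable {k : Type*} [Field k] {A : Type*} [LeftPreLieRing A] [LeftPreLieAlgebra k A]

theorem bSeries_snd (γ : Module.Dual k (TreeSpace k × k)) (a : A) :
    (bSeries γ a).2 = treeSeries a fun t => γ (tree k t, 0) :=
  rfl

theorem coeff_formalBSeries (γ : Module.Dual k (TreeSpace k × k)) (x : HahnSeries ℕ A) (n : ℕ) :
    (formalBSeries γ x).2.coeff n = (elementaryDifferential k (mulH x)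
      (truncatedDual n fun t => γ (tree k t, 0))).coeff n := by
  simp only [formalBSeries, coeff_formalSeries, truncatedDual, map_sum, map_smul,
    HahnSeries.coeff_sum, HahnSeries.coeff_smul, elementaryDifferential_centroidHom]
  refine Finset.sum_congr rfl fun m hm => Finset.sum_congr rfl fun t ht => ?_
  obtain ⟨l, rfl⟩ := Nat.exists_eq_add_of_le (Finset.mem_range_succ_iff.1 hm)
  rw [mem_ofOrder.1 ht, coeff_mulH_pow, Nat.add_sub_cancel_left, bWeight]

theorem coeff_formalBSeries_divH_bSeries [CharZero k] (a : A)
    (α β : Module.Dual k (TreeSpace k × k)) (n : ℕ) :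
    (formalBSeries β (divH (bSeries α a).2)).2.coeff n =
      (treeSeries a
        (substitution (fun t => α (tree k t, 0)) fun t => β (tree k t, 0))).coeff n := by
  rw [coeff_formalBSeries, mulH_divH (coeff_zero_bSeries _ _), bSeries_snd,
    elementaryDifferential_treeSeries, LinearMap.comp_apply, LinearMap.comp_apply]
  exact coeff_treeSeries_congr a fun t ht => substitution_congr _ fun u hu =>
    pairing_truncatedDual (fun t => β (tree k t, 0)) (hu.trans_eq ht)

end BSeries

theorem mainTheorem5 {k : Type*} [Field k] [CharZero k] {A : Type*} [LeftPreLieRing A]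
    [LeftPreLieAlgebra k A] (a : A) (α β : Module.Dual k (TreeSpace k)) :
    formalBSeries (extendByZero β) (divH (bSeries (extendByZero α) a).2) =
      bSeries (ForestAlgebra.restrict
        (ForestAlgebra.convolution (ForestAlgebra.character α).toLinearMap
          (ForestAlgebra.infinitesimalCharacter β))) a := by
  refine Prod.ext ?_ ?_
  · exact (map_zero β).trans (ForestAlgebra.restrict_convolution_one α β).symm
  · ext n
    rw [coeff_formalBSeries_divH_bSeries, bSeries_snd,
      funext (ForestAlgebra.restrict_convolution_tree α β)]
    rfl
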